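/- Let $0\le i\le k$ and $r,d\ge 0$ be integers. Let $\mathcal O\subset\mathbb R^k$ be a $(k,i)$-orange: a finite pure $k$-dimensional simplicial complex with exactly one $(k-i)$-dimensional face $\tau$ (the medial simplex) contained in every maximal face. Assume that $\tau$ lies in the subspace $x_1=\dots=x_i=0$ and that its vertices are $v_0=O$ (the origin) and $v_1,\dots,v_{k-i}$. Let $\mathcal C=\{\pi(\sigma):\sigma\in\mathcal O\}$ be the projected orange, where $\pi(x_1,\dots,x_k)=(x_1,\dots,x_i)$, let $\mathbb R^i$ be embedded in $\mathbb R^k$ as $x_{i+1}=\dots=x_k=0$, and let $\mathcal O'=\mathcal C*\tau$ be the complex of the simplices $\omega*v_1*\cdots*v_{k-i}$, $\omega\in\mathcal C$, and their faces. For a simplicial partition $\Delta$, let $S^r_d(\Delta)$ be the space of $C^r$ functions on the underlying set of $\Delta$ that are polynomials of degree at most $d$ on every maximal simplex. The domain points of degree $d$ of a simplex with vertices $w_0,\dots,w_m$ are $\xi_{\alpha}=\frac1d\sum_s\alpha_s w_s$ with integers $\alpha_s\ge 0$, $\sum_s\alpha_s=d$ (for $d=0$, where every partition considered has the origin in all its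 maximal simplices, the only domain point is the origin). The Bernstein–Bézier coefficients $c_\xi$ of a spline, indexed by the domain points of the maximal simplices of $\Delta$, are given on each maximal simplex by $f=\sum_{|\alpha|=d}c_{\xi_\alpha}\frac{d!}{\alpha!}b^\alpha$, where $b$ are the barycentric coordinates. A determining set for $S^r_d(\Delta)$ is a set $\mathcal M$ of domain points such that a spline $f\in S^r_d(\Delta)$ with $c_\xi=0$ for all $\xi\in\mathcal M$ is zero; it is minimal if no determining set has fewer elements. For $0\le j\le d$ let $\mathcal C_j=(j/d)\,\mathcal C$ (for $j=0$ the single vertex $O$), and let $\mathcal M_j$ be any minimal determining set for $S^r_j(\mathcal C_j)$. Let $\mathcal D^\tau$ be the set of domain points $\xi_{j_0,\dots,j_{k-i}}=(j_1v_1+\dots+j_{k-i}v_{k-i})/d$, $j_0+\dots+j_{k-i}=d$, of $\tau$. Then $$\mathcal M'=\bigcup_{j=0}^d\bigl\{\mathcal M_j+\xi_{j,j_1,\dots,j_{k-i}}:\ \xi_{j,j_1,\dots,j_{k-i}}\in\mathcal D^\tau\bigr\}$$ is a minimal determining set for $S^r_d(\mathcal O')$, and $$\dim S^r_d(\mathcal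 O')=|\mathcal M'|=\sum_{j=0}^d\binom{d+k-j-i-1}{k-i-1}\,|\mathcal M_j|,\qquad |\mathcal M_j|=\dim S^r_j(\mathcal C)\quad(0\le j\le d),$$ where for $i=k$ the binomial coefficient is read as $1$ if $j=d$ and $0$ if $j<d$. -/

import Mathlib

namespace BBSpline

/-! Simplices of `ℝⁿ` are represented by their finite vertex sets, and a simplicial partition by the
set `K` of the vertex sets of its faces. -/

/-- The underlying domain: the union of the simplices of `K`. -/
def domain {n : ℕ} (K : Set (Finset (Fin n → ℝ))) : Set (Fin n → ℝ) :=
  ⋃ s ∈ K, convexHull ℝ (s : Set (Fin n → ℝ))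

/-- The maximal faces of `K`. -/
def maximalFaces {n : ℕ} (K : Set (Finset (Fin n → ℝ))) : Set (Finset (Fin n → ℝ)) :=
  {s | s ∈ K ∧ ∀ t ∈ K, s ⊆ t → s = t}

/-- The spline space `S^r_d(K)`: the `C^r` functions on the domain of `K` which, on every maximal
face of `K`, are given by a polynomial of total degree at most `d`. -/
def splineSpace {n : ℕ} (K : Set (Finset (Fin n → ℝ))) (r d : ℕ) :
    Submodule ℝ (domain K → ℝ) where
  carrier := {f | ∃ F : (Fin n → ℝ) → ℝ, (∀ x : domain K, F x = f x) ∧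
    ContDiffOn ℝ r F (domain K) ∧
    ∀ s ∈ maximalFaces K, ∃ p : MvPolynomial (Fin n) ℝ, p.totalDegree ≤ d ∧
      ∀ x ∈ convexHull ℝ (s : Set (Fin n → ℝ)), F x = MvPolynomial.eval x p}
  zero_mem' := ⟨0, fun _ => rfl, contDiffOn_const, fun _ _ => ⟨0, by simp, fun _ _ => by simp⟩⟩
  add_mem' := by
    rintro f g ⟨F, hF, hFc, hFp⟩ ⟨G, hG, hGc, hGp⟩
    refine ⟨F + G, fun x => by simp [hF, hG], hFc.add hGc, fun s hs => ?_⟩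
    obtain ⟨p, hp, hpe⟩ := hFp s hs
    obtain ⟨q, hq, hqe⟩ := hGp s hs
    exact ⟨p + q, (MvPolynomial.totalDegree_add p q).trans (max_le hp hq),
      fun x hx => by simp [hpe x hx, hqe x hx]⟩
  smul_mem' := by
    rintro c f ⟨F, hF, hFc, hFp⟩
    refine ⟨c • F, fun x => by simp [hF], contDiffOn_const.smul hFc, fun s hs => ?_⟩
    obtain ⟨p, hp, hpe⟩ := hFp s hs
    exact ⟨c • p, (MvPolynomial.totalDegree_smul_le c p).trans hp,
      fun x hx => by simp [hpe x hx]⟩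

/-- The domain point `(1/d) ∑ α_v v` of degree `d` with indices `α` in the simplex with vertex set
`s`. For `d = 0` all indices vanish, and the point is the origin (which is a vertex of every simplex
for which this case is used). -/
noncomputable def domainPoint {n : ℕ} (s : Finset (Fin n → ℝ)) (d : ℕ) (α : (Fin n → ℝ) → ℕ) :
    Fin n → ℝ :=
  (d : ℝ)⁻¹ • ∑ v ∈ s, (α v : ℝ) • v

/-- All domain points of degree `d` of the partition `K`. -/
def domainPoints {n : ℕ} (K : Set (Finset (Fin n → ℝ))) (d : ℕ) : Set (Fin n → ℝ) :=
  {ξ | ∃ s ∈ maximalFaces K, ∃ α ∈ s.piAntidiag d, ξ = domainPoint s d α}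

/-- `c` gives the Bernstein–Bézier coefficients of degree `d` of the function `f` on the domain of
`K`: on every maximal face `s`, at the point with barycentric coordinates `w`,
`f = ∑_{|α| = d} c(ξ_α) (d! / α!) w ^ α`. (Values of `c` off the domain points play no role.) -/
def IsBForm {n : ℕ} (K : Set (Finset (Fin n → ℝ))) (d : ℕ) (f : domain K → ℝ)
    (c : (Fin n → ℝ) → ℝ) : Prop :=
  ∀ s ∈ maximalFaces K, ∀ w : (Fin n → ℝ) → ℝ, (∀ v ∈ s, 0 ≤ w v) → ∑ v ∈ s, w v = 1 →
    ∀ x : domain K, (x : Fin n → ℝ) = ∑ v ∈ s, w v • v →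
      f x = ∑ α ∈ s.piAntidiag d,
        c (domainPoint s d α) * ((Nat.multinomial s α : ℝ) * ∏ v ∈ s, w v ^ α v)

/-- `M` is a determining set for `S^r_d(K)`: a set of domain points such that a spline whose
Bernstein–Bézier coefficients at the points of `M` all vanish is zero. -/
def IsDeterminingSet {n : ℕ} (K : Set (Finset (Fin n → ℝ))) (r d : ℕ)
    (M : Set (Fin n → ℝ)) : Prop :=
  M ⊆ domainPoints K d ∧
    ∀ f ∈ splineSpace K r d, ∀ c, IsBForm K d f c → (∀ ξ ∈ M, c ξ = 0) → f = 0

/-- `M` is a minimal determining set for `S^r_d(K)`: no determining set has fewer elements. -/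
def IsMinimalDeterminingSet {n : ℕ} (K : Set (Finset (Fin n → ℝ))) (r d : ℕ)
    (M : Set (Fin n → ℝ)) : Prop :=
  IsDeterminingSet K r d M ∧ ∀ N, IsDeterminingSet K r d N → M.encard ≤ N.encard

/-- `O` is a `(k,i)`-orange with medial simplex `τ`: a finite pure `k`-dimensional simplicial
complex with exactly one face `τ` of dimension `k - i` that lies in every maximal face. -/
structure IsOrange {k : ℕ} (i : ℕ) (O : Geometry.SimplicialComplex ℝ (Fin k → ℝ))
    (τ : Finset (Fin k → ℝ)) : Prop where
  finite : O.faces.Finite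
  pure : ∀ s ∈ O.facets, s.card = k + 1
  mem : τ ∈ O.faces
  card : τ.card = k - i + 1
  medial : ∀ s ∈ O.facets, τ ⊆ s
  unique : ∀ τ' ∈ O.faces, τ'.card = k - i + 1 → (∀ s ∈ O.facets, τ' ⊆ s) → τ' = τ

/-- The projection `(x₁, …, x_k) ↦ (x₁, …, x_i)`. -/
def proj {i k : ℕ} (h : i ≤ k) (x : Fin k → ℝ) : Fin i → ℝ := fun a => x (Fin.castLE h a)

/-- The embedding `(x₁, …, x_i) ↦ (x₁, …, x_i, 0, …, 0)` of `ℝⁱ` into `ℝᵏ`. -/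
def embed {i : ℕ} (k : ℕ) (y : Fin i → ℝ) : Fin k → ℝ :=
  fun b => if hb : (b : ℕ) < i then y ⟨b, hb⟩ else 0

/-- The projected orange: the projections of the faces of `O`. -/
noncomputable def projectedOrange {i k : ℕ} (h : i ≤ k)
    (O : Geometry.SimplicialComplex ℝ (Fin k → ℝ)) : Set (Finset (Fin i → ℝ)) :=
  (fun s : Finset (Fin k → ℝ) => s.image (proj h)) '' O.faces

/-- The scaled partition `a K`. For `a = 0` (and `K` nonempty) it is the single vertex `0`. -/
noncomputable def scale {n : ℕ} (a : ℝ) (K : Set (Finset (Fin n → ℝ))) :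
    Set (Finset (Fin n → ℝ)) :=
  (fun s : Finset (Fin n → ℝ) => s.image (fun x => a • x)) '' K

/-- The special orange `C * τ`: the simplices `ω * v₁ * ⋯ * v_{k-i}`, `ω ∈ C`, and their faces,
where `v₁, …, v_{k-i}` are the vertices of `τ` other than the origin. -/
def specialOrange {i k : ℕ} (C : Set (Finset (Fin i → ℝ))) (τ : Finset (Fin k → ℝ)) :
    Set (Finset (Fin k → ℝ)) :=
  {t | t.Nonempty ∧ ∃ ω ∈ C, t ⊆ ω.image (embed k) ∪ τ.erase 0}

/-- The domain points of degree `d` of `τ` whose first index, that of the vertex `0`, is `j`. -/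
def medialPoints {k : ℕ} (τ : Finset (Fin k → ℝ)) (d j : ℕ) : Set (Fin k → ℝ) :=
  {ξ | ∃ α ∈ τ.piAntidiag d, α 0 = j ∧ ξ = domainPoint τ d α}

/-- The union over `j = 0, …, d` of the translates of `M_j` (placed in `ℝᵏ`) by the domain points
of degree `d` of `τ` with first index `j`. -/
def layeredSet {i k : ℕ} (τ : Finset (Fin k → ℝ)) (d : ℕ) (M : ℕ → Set (Fin i → ℝ)) :
    Set (Fin k → ℝ) :=
  {x | ∃ j ≤ d, ∃ y ∈ M j, ∃ ξ ∈ medialPoints τ d j, x = embed k y + ξ}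

/-- The binomial coefficient `(d+k-j-i-1 choose k-i-1)` for `j ≤ d`, `i ≤ k`, with the usual
convention for `i = k`: `(d-j-1 choose -1)` is `1` if `j = d` and `0` if `j < d`. -/
def layerCount (k i d j : ℕ) : ℕ :=
  if i < k then (d + k - j - i - 1).choose (k - i - 1) else if j = d then 1 else 0

end BBSpline

/-! Write a point of the special orange as `embed k (θ 0 • u) + ∑ θ v • v`, with `θ` a barycentric
weight on `τ` and `u` in the domain of `C`: the weight of the origin is redistributed over a simplex
of `C`. Grouping the Bernstein sum of a spline by the index `γ` on `τ` gives `∑ γ, B_γ(θ) g_γ(u)`,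
where `B_γ` are the Bernstein polynomials of `τ` and the layer `g_γ` is a Bernstein sum of degree `γ
0` on `C` (`bernsteinSum_join`).

Upper bound. Every Bernstein coefficient is a finite combination of point values
(`exists_dual_weights`), so `g_γ` is a finite combination of slices of the spline at fixed `θ`;
hence it is itself a `C^r` spline of degree `γ 0` on `C` (`exists_isSpline_layer`). Scaled by `γ 0 /
d`, its coefficients sit at the domain points of the spline translated to the origin, so `M (γ 0)`
determines it. Thus the layered set is determining (`isDeterminingSet_layeredSet`), and by
construction it has at most `∑ γ, dim S^r_{γ 0}(C)` points (`encard_layeredSet_le`).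

Lower bound. With linear coordinates `t_v` along the medial simplex, `(G_γ) ↦ ∑ γ, t ^ γ * G_γ(proj
x)` sends families of splines on `C` of degrees `γ 0` to splines on the special orange. It is
injective because monomials in `t` are independent on a small box
(`sum_finrank_le_finrank_specialOrange`).

A determining set has at least as many points as the dimension, so the two bounds force equality
throughout. A set of domain points is minimal determining exactly when it is determining and its
size is the dimension (`IsFan.isMinimalDeterminingSet_iff`). Grouping the indices `γ` by `γ 0`
produces the binomial coefficients.

The common setting for `C`, its scalings and the special orange is `IsFan`: all maximal simplices
contain the origin and conical representations are unique. This is exactly what makes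
Bernstein–Bézier coefficients well defined across simplices. -/

namespace BBSpline

open MvPolynomial

/-! ### Bernstein sums on an abstract vertex set -/

section Bernstein

variable {X : Type*} [DecidableEq X]

/-- The polynomial in the weights `w` with Bernstein coefficients `c` of degree `d` on the vertex
set `s`. -/
noncomputable def bernsteinSum (s : Finset X) (d : ℕ) (c : (X → ℕ) → ℝ) (w : X → ℝ) : ℝ :=
  ∑ α ∈ s.piAntidiag d, c α * ((Nat.multinomial s α : ℝ) * ∏ v ∈ s, w v ^ α v)

/-- `w` is a family of barycentric weights on `s`. -/
structure IsWeight (s : Finset X) (w : X → ℝ) : Prop where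
  nonneg : ∀ v, 0 ≤ w v
  eq_zero : ∀ v, v ∉ s → w v = 0
  sum_eq : ∑ v ∈ s, w v = 1

lemma bernsteinSum_congr {s : Finset X} {d : ℕ} {c c' : (X → ℕ) → ℝ} {w w' : X → ℝ}
    (hc : ∀ α ∈ s.piAntidiag d, c α = c' α) (hw : ∀ v ∈ s, w v = w' v) :
    bernsteinSum s d c w = bernsteinSum s d c' w' := by
  refine Finset.sum_congr rfl fun α hα => ?_
  rw [hc α hα, Finset.prod_congr rfl fun v hv => by rw [hw v hv]]

lemma bernsteinSum_sub {s : Finset X} {d : ℕ} {c c' : (X → ℕ) → ℝ} {w : X → ℝ} :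
    bernsteinSum s d (fun α => c α - c' α) w = bernsteinSum s d c w - bernsteinSum s d c' w := by
  simp only [bernsteinSum, sub_mul, Finset.sum_sub_distrib]

/-- Weights vanishing off `s` kill every monomial involving another variable; by homogeneity the
surviving exponents are supported in `s` with sum `d`. -/
lemma eval_eq_sum_piAntidiag {P : MvPolynomial X ℝ} {d : ℕ} (hP : P.IsHomogeneous d)
    (s : Finset X) {w : X → ℝ} (hw : ∀ v, v ∉ s → w v = 0) :
    eval w P = ∑ α ∈ s.piAntidiag d,
      coeff (Finsupp.indicator s fun v _ => α v) P * ∏ v ∈ s, w v ^ α v := by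
  have h1 : eval w P = ∑ m ∈ s.finsuppAntidiag d, coeff m P * ∏ v ∈ s, w v ^ m v := by
    rw [eval_eq]
    refine Finset.sum_congr_of_eq_on_inter ?_ ?_ ?_
    · intro m hm hms
      have : ¬ m.support ⊆ s := by
        intro h
        apply hms
        rw [Finset.mem_finsuppAntidiag]
        refine ⟨?_, h⟩
        have := hP (mem_support_iff.1 hm)
        rw [← this, Finsupp.weight_apply, Finsupp.sum_of_support_subset _ h _ (by simp)]
        simp
      obtain ⟨v, hv, hvs⟩ := Finset.not_subset.1 this
      rw [Finset.prod_eq_zero hv, mul_zero]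
      rw [hw v hvs, zero_pow (Finsupp.mem_support_iff.1 hv)]
    · intro m _ hm
      rw [notMem_support_iff.1 hm, zero_mul]
    · intro m _ hm
      congr 1
      refine Finset.prod_subset (Finset.mem_finsuppAntidiag.1 hm).2 ?_
      intro v _ hv
      rw [Finsupp.notMem_support_iff.1 hv, pow_zero]
  rw [h1]
  refine Finset.sum_bij' (fun m _ => ⇑m) (fun α _ => Finsupp.indicator s fun v _ => α v)
    ?_ ?_ ?_ ?_ ?_
  · intro m hm
    rw [Finset.mem_finsuppAntidiag] at hm
    rw [Finset.mem_piAntidiag]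
    exact ⟨hm.1, fun v hv => hm.2 (Finsupp.mem_support_iff.2 hv)⟩
  · intro α hα
    rw [Finset.mem_piAntidiag] at hα
    rw [Finset.mem_finsuppAntidiag]
    refine ⟨?_, Finsupp.support_indicator_subset ..⟩
    rw [← hα.1]
    exact Finset.sum_congr rfl fun v hv => Finsupp.indicator_of_mem hv _
  · intro m hm
    ext v
    by_cases hv : v ∈ s
    · simp [Finsupp.indicator_of_mem hv]
    · rw [Finset.mem_finsuppAntidiag] at hm
      rw [Finsupp.indicator_of_notMem hv]
      by_contra h
      exact hv (hm.2 (Finsupp.mem_support_iff.2 (Ne.symm h)))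
  · intro α hα
    rw [Finset.mem_piAntidiag] at hα
    ext v
    by_cases hv : v ∈ s
    · simp [Finsupp.indicator_of_mem hv]
    · rw [Finsupp.indicator_of_notMem hv]
      by_contra h
      exact hv (hα.2 v (Ne.symm h))
  · intro m hm
    rw [Finset.mem_finsuppAntidiag] at hm
    congr 2
    ext v
    by_cases hv : v ∈ s
    · simp [Finsupp.indicator_of_mem hv]
    · rw [Finsupp.indicator_of_notMem hv]
      by_contra h
      exact hv (hm.2 (Finsupp.mem_support_iff.2 h))

/-- Monomials of degree `d` in the variables of `s` are linearly independent on any box with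
infinite sides. -/
lemma eq_zero_of_sum_monomial_eq_zero {s : Finset X} (A : Finset (X → ℕ))
    (hA : ∀ α ∈ A, ∀ β ∈ A, (∀ v ∈ s, α v = β v) → α = β)
    {c : (X → ℕ) → ℝ} {I : Set ℝ} (hI : I.Infinite)
    (h : ∀ w : X → ℝ, (∀ v, w v ∈ I) → ∑ α ∈ A, c α * ∏ v ∈ s, w v ^ α v = 0) :
    ∀ α ∈ A, c α = 0 := by
  have hinj : ∀ α ∈ A, ∀ β ∈ A,
      (Finsupp.indicator s fun v _ => α v) = (Finsupp.indicator s fun v _ => β v) → α = β := by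
    intro α hα β hβ he
    refine hA α hα β hβ fun v hv => ?_
    have := DFunLike.congr_fun he v
    simpa [Finsupp.indicator_of_mem hv] using this
  have hP : (∑ α ∈ A, monomial (Finsupp.indicator s fun v _ => α v) (c α) :
      MvPolynomial X ℝ) = 0 := by
    refine funext_set (fun _ => I) (fun _ => hI) fun w hw => ?_
    rw [map_zero, map_sum, ← h w fun v => hw v trivial]
    refine Finset.sum_congr rfl fun α _ => ?_
    rw [eval_monomial, Finsupp.prod_of_support_subset _ (Finsupp.support_indicator_subset ..) _
      (by simp)]
    congr 1
    exact Finset.prod_congr rfl fun v hv => by rw [Finsupp.indicator_of_mem hv]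
  intro α hα
  have := congrArg (coeff (Finsupp.indicator s fun v _ => α v)) hP
  rw [coeff_sum, coeff_zero, Finset.sum_eq_single α] at this
  · simpa using this
  · intro β hβ hne
    rw [coeff_monomial, if_neg fun he => hne (hinj _ hβ _ hα he)]
  · exact fun h => absurd hα h

/-- Bernstein coefficients are determined by the values on barycentric weights. -/
lemma bernsteinSum_injective {s : Finset X} (hs : s.Nonempty) {d : ℕ} {c c' : (X → ℕ) → ℝ}
    (h : ∀ w, IsWeight s w → bernsteinSum s d c w = bernsteinSum s d c' w) :
    ∀ α ∈ s.piAntidiag d, c α = c' α := by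
  have key := eq_zero_of_sum_monomial_eq_zero (s := s) (s.piAntidiag d)
    (c := fun α => (c α - c' α) * Nat.multinomial s α) (I := Set.Ioi 0) ?_ (Set.Ioi_infinite 0) ?_
  · intro α hα
    have := key α hα
    have h2 : (Nat.multinomial s α : ℝ) ≠ 0 := by
      exact_mod_cast (Nat.multinomial_pos s α).ne'
    rw [mul_eq_zero, or_iff_left h2] at this
    linarith
  · intro α hα β hβ he
    rw [Finset.mem_piAntidiag] at hα hβ
    ext v
    by_cases hv : v ∈ s
    · exact he v hv
    · rw [not_imp_comm.1 (hα.2 v) hv, not_imp_comm.1 (hβ.2 v) hv]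
  · intro w hw
    -- A Bernstein sum is homogeneous of degree `d`, so its vanishing on normalized weights extends
    -- to all positive `w` with a factor `S ^ d`. The monomials can then be tested on an open
    -- orthant.
    set S := ∑ v ∈ s, w v with hS
    have hSpos : 0 < S := Finset.sum_pos (fun v _ => hw v) hs
    have h0 : bernsteinSum s d (fun α => c α - c' α)
        (fun v => if v ∈ s then w v / S else 0) = 0 := by
      rw [bernsteinSum_sub, h, sub_self]
      refine ⟨fun v => ?_, fun v hv => if_neg hv, ?_⟩
      · split_ifs
        · exact div_nonneg (le_of_lt (hw v)) hSpos.le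
        · exact le_rfl
      · rw [Finset.sum_congr rfl fun v hv => if_pos hv, ← Finset.sum_div, div_self hSpos.ne']
    have h1 : ∑ α ∈ s.piAntidiag d, (c α - c' α) * Nat.multinomial s α * ∏ v ∈ s, w v ^ α v =
        S ^ d * bernsteinSum s d (fun α => c α - c' α) (fun v => if v ∈ s then w v / S else 0) := by
      rw [bernsteinSum, Finset.mul_sum]
      refine Finset.sum_congr rfl fun α hα => ?_
      have h2 : ∏ v ∈ s, (if v ∈ s then w v / S else 0) ^ α v = ∏ v ∈ s, w v ^ α v / S ^ α v :=
        Finset.prod_congr rfl fun v hv => by rw [if_pos hv, div_pow]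
      rw [h2, Finset.prod_div_distrib, Finset.prod_pow_eq_pow_sum, (Finset.mem_piAntidiag.1 hα).1]
      field_simp
    rw [h1, h0, mul_zero]

/-- On weights vanishing off `u`, only the coefficients of the face `u` matter. -/
lemma bernsteinSum_subset {s u : Finset X} (hus : u ⊆ s) {d : ℕ} {c : (X → ℕ) → ℝ} {w : X → ℝ}
    (hw : ∀ v, v ∉ u → w v = 0) : bernsteinSum s d c w = bernsteinSum u d c w := by
  symm
  unfold bernsteinSum
  have hsub : u.piAntidiag d ⊆ s.piAntidiag d := by
    intro α hα
    rw [Finset.mem_piAntidiag] at hα ⊢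
    refine ⟨?_, fun v hv => hus (hα.2 v hv)⟩
    rw [← hα.1]
    exact (Finset.sum_subset hus fun v _ hv => not_imp_comm.1 (hα.2 v) hv).symm
  rw [← Finset.sum_subset hsub]
  · refine Finset.sum_congr rfl fun α hα => ?_
    rw [Finset.mem_piAntidiag] at hα
    congr 2
    · congr 1
      exact Nat.multinomial_congr_of_sdiff hus
        (fun v hv => not_imp_comm.1 (hα.2 v) (Finset.mem_sdiff.1 hv).2) fun _ _ => rfl
    · refine Finset.prod_subset hus fun v _ hv => ?_
      rw [not_imp_comm.1 (hα.2 v) hv, pow_zero]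
  · intro α hα hαu
    have : ∃ v ∈ s, v ∉ u ∧ α v ≠ 0 := by
      by_contra! hcon
      apply hαu
      rw [Finset.mem_piAntidiag] at hα ⊢
      refine ⟨?_, fun v hv => ?_⟩
      · rw [← hα.1]
        exact Finset.sum_subset hus fun v hvs hv => hcon v hvs hv
      · by_contra hvu
        exact hv (hcon v (hα.2 v hv) hvu)
    obtain ⟨v, hvs, hvu, hv⟩ := this
    rw [Finset.prod_eq_zero hvs, mul_zero, mul_zero]
    rw [hw v hvu, zero_pow hv]

/-- Each Bernstein coefficient is a finite combination of values at barycentric weights. -/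
lemma exists_dual_weights {s : Finset X} (hs : s.Nonempty) (d : ℕ) {γ : X → ℕ}
    (hγ : γ ∈ s.piAntidiag d) :
    ∃ μ : {w : X → ℝ // IsWeight s w} →₀ ℝ, ∀ q : (X → ℕ) → ℝ,
      ∑ w ∈ μ.support, μ w * bernsteinSum s d q w.1 = q γ := by
  classical
  let e : {w : X → ℝ // IsWeight s w} → (s.piAntidiag d → ℝ) :=
    fun w β => (Nat.multinomial s β.1 : ℝ) * ∏ v ∈ s, w.1 v ^ β.1 v
  -- Otherwise a nonzero functional `φ` kills all evaluation vectors. Its coordinates are Bernstein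
  -- coefficients of a sum vanishing at every weight, contradicting `bernsteinSum_injective`.
  have htop : Submodule.span ℝ (Set.range e) = ⊤ := by
    by_contra hne
    obtain ⟨φ, hφ, hle⟩ := Submodule.exists_le_ker_of_lt_top _ (lt_top_iff_ne_top.2 hne)
    apply hφ
    let c : (X → ℕ) → ℝ := fun β => if hβ : β ∈ s.piAntidiag d then φ (Pi.single ⟨β, hβ⟩ 1) else 0
    have hc := bernsteinSum_injective hs (d := d) (c := c) (c' := 0) ?_
    · refine LinearMap.pi_ext' fun β => ?_
      ext
      have := hc β.1 β.2
      simp only [c, dif_pos β.2] at this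
      simpa using this
    · intro w hw
      have h1 : φ (e ⟨w, hw⟩) = 0 := hle (Submodule.subset_span ⟨_, rfl⟩)
      have h2 : φ (e ⟨w, hw⟩) = bernsteinSum s d c w := by
        rw [LinearMap.pi_apply_eq_sum_univ φ, bernsteinSum,
          ← Finset.sum_coe_sort (s.piAntidiag d)
            fun α => c α * ((Nat.multinomial s α : ℝ) * ∏ v ∈ s, w v ^ α v)]
        refine Finset.sum_congr rfl fun β _ => ?_
        have h3 : c β.1 = φ (Pi.single β 1) := dif_pos β.2
        rw [h3, smul_eq_mul, mul_comm]
        congr 2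
        ext β'
        simp [Pi.single_apply, eq_comm]
      rw [← h2, h1]
      simp [bernsteinSum]
  have hmem : (Pi.single ⟨γ, hγ⟩ 1 : s.piAntidiag d → ℝ) ∈ Submodule.span ℝ (Set.range e) := by
    rw [htop]; trivial
  obtain ⟨μ, hμ⟩ := (Finsupp.mem_span_range_iff_exists_finsupp).1 hmem
  refine ⟨μ, fun q => ?_⟩
  have h1 : ∀ β : s.piAntidiag d, ∑ w ∈ μ.support, μ w * e w β = if β.1 = γ then 1 else 0 := by
    intro β
    have := congrFun hμ β
    rw [Finsupp.sum, Finset.sum_apply] at this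
    simpa [Pi.single_apply, Subtype.ext_iff] using this
  simp only [bernsteinSum, Finset.mul_sum]
  rw [Finset.sum_comm]
  have h2 : ∀ β ∈ s.piAntidiag d, ∑ w ∈ μ.support,
      μ w * (q β * ((Nat.multinomial s β : ℝ) * ∏ v ∈ s, w.1 v ^ β v)) =
        if β = γ then q β else 0 := by
    intro β hβ
    rw [← mul_one (q β), ← mul_zero (q β), ← mul_ite, ← h1 ⟨β, hβ⟩, Finset.mul_sum]
    refine Finset.sum_congr rfl fun w _ => ?_
    simp only [e]
    ring
  rw [Finset.sum_congr rfl h2, Finset.sum_ite_eq' _ _ _, if_pos hγ]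

end Bernstein

/-! ### Polynomials versus Bernstein sums on a simplex -/

section Polynomial

variable {n : ℕ}

/-- Polynomials of total degree at most `d` have Bernstein coefficients of degree `d`. -/
lemma exists_bernsteinSum_eq (p : MvPolynomial (Fin n) ℝ) {d : ℕ} (hp : p.totalDegree ≤ d)
    (s : Finset (Fin n → ℝ)) :
    ∃ c, ∀ w : (Fin n → ℝ) → ℝ, ∑ v ∈ s, w v = 1 →
      eval (∑ v ∈ s, w v • v) p = bernsteinSum s d c w := by
  -- Substitute the vertex combination for the variables and homogenize: the power of `∑ X v` fills
  -- each monomial up to degree `d` and equals `1` on weights of total `1`.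
  let P : MvPolynomial (Fin n → ℝ) ℝ := ∑ m ∈ p.support, C (coeff m p) *
    (∏ a ∈ m.support, (∑ v ∈ s, C (v a) * X v) ^ m a) * (∑ v ∈ s, X v) ^ (d - ∑ a ∈ m.support, m a)
  have hP : P.IsHomogeneous d := by
    refine IsHomogeneous.sum _ _ _ fun m hm => ?_
    have hle : ∑ a ∈ m.support, m a ≤ d := (le_totalDegree hm).trans hp
    have h1 : (∏ a ∈ m.support, (∑ v ∈ s, C (v a) * X v : MvPolynomial (Fin n → ℝ) ℝ) ^ m a
        ).IsHomogeneous (∑ a ∈ m.support, m a) := by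
      refine IsHomogeneous.prod _ _ _ fun a _ => ?_
      have : (∑ v ∈ s, C (v a) * X v : MvPolynomial (Fin n → ℝ) ℝ).IsHomogeneous 1 :=
        IsHomogeneous.sum _ _ _ fun v _ => by
          simpa using (isHomogeneous_C _ (v a)).mul (isHomogeneous_X ℝ v)
      simpa using this.pow (m a)
    have h2 : ((∑ v ∈ s, X v : MvPolynomial (Fin n → ℝ) ℝ) ^ (d - ∑ a ∈ m.support, m a)
        ).IsHomogeneous (d - ∑ a ∈ m.support, m a) := by
      have : (∑ v ∈ s, X v : MvPolynomial (Fin n → ℝ) ℝ).IsHomogeneous 1 :=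
        IsHomogeneous.sum _ _ _ fun v _ => isHomogeneous_X ℝ v
      simpa using this.pow (d - ∑ a ∈ m.support, m a)
    have h3 := ((isHomogeneous_C (Fin n → ℝ) (coeff m p)).mul h1).mul h2
    rwa [zero_add, Nat.add_sub_cancel' hle] at h3
  refine ⟨fun α => coeff (Finsupp.indicator s fun v _ => α v) P / Nat.multinomial s α,
    fun w hw => ?_⟩
  let w' : (Fin n → ℝ) → ℝ := fun v => if v ∈ s then w v else 0
  have hw' : ∀ v ∈ s, w' v = w v := fun v hv => if_pos hv
  have h1 := eval_eq_sum_piAntidiag hP s (w := w') fun v hv => if_neg hv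
  have h2 : eval w' P = eval (∑ v ∈ s, w v • v) p := by
    rw [eval_eq (∑ v ∈ s, w v • v) p, map_sum]
    refine Finset.sum_congr rfl fun m _ => ?_
    simp only [map_mul, map_prod, map_pow, map_sum, eval_C, eval_X]
    rw [Finset.sum_congr rfl hw', hw, one_pow, mul_one]
    congr 1
    refine Finset.prod_congr rfl fun a _ => ?_
    congr 1
    rw [Finset.sum_apply]
    exact Finset.sum_congr rfl fun v hv => by rw [hw' v hv, Pi.smul_apply, smul_eq_mul, mul_comm]
  rw [← h2, h1, bernsteinSum]
  refine Finset.sum_congr rfl fun α _ => ?_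
  have h3 : (Nat.multinomial s α : ℝ) ≠ 0 := by exact_mod_cast (Nat.multinomial_pos s α).ne'
  rw [Finset.prod_congr rfl fun v hv => by rw [hw' v hv]]
  field_simp

/-- The linear polynomial of a linear functional. -/
noncomputable def dualPoly (L : Module.Dual ℝ (Fin n → ℝ)) : MvPolynomial (Fin n) ℝ :=
  ∑ a, C (L (Pi.single a 1)) * X a

lemma eval_dualPoly (L : Module.Dual ℝ (Fin n → ℝ)) (x : Fin n → ℝ) :
    eval x (dualPoly L) = L x := by
  rw [LinearMap.pi_apply_eq_sum_univ L x, dualPoly, map_sum]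
  refine Finset.sum_congr rfl fun a _ => ?_
  rw [map_mul, eval_C, eval_X, smul_eq_mul, mul_comm]
  congr 2
  ext b
  simp [Pi.single_apply, eq_comm]

lemma totalDegree_dualPoly_le (L : Module.Dual ℝ (Fin n → ℝ)) :
    (dualPoly L).totalDegree ≤ 1 := by
  refine totalDegree_finsetSum_le fun a _ => (totalDegree_mul _ _).trans ?_
  simp

/-- The coordinate functionals of a linearly independent family. -/
lemma exists_dual_family {V : Type*} [AddCommGroup V] [Module ℝ V] {T : Finset V}
    (hT : LinearIndepOn ℝ id (T : Set V)) :
    ∃ l : V → Module.Dual ℝ V, ∀ v ∈ T, ∀ c : V → ℝ, l v (∑ u ∈ T, c u • u) = c v := by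
  classical
  let b := Module.Basis.extend hT
  have hsub := hT.subset_extend (Set.subset_univ _)
  refine ⟨fun v => if h : v ∈ hT.extend (Set.subset_univ _) then b.coord ⟨v, h⟩ else 0,
    fun v hv c => ?_⟩
  simp only [dif_pos (hsub hv)]
  rw [map_sum, Finset.sum_eq_single v]
  · have : b ⟨v, hsub hv⟩ = v := Module.Basis.extend_apply_self ..
    have h2 : b.coord ⟨v, hsub hv⟩ (b ⟨v, hsub hv⟩) = 1 := by simp
    rw [this] at h2
    rw [map_smul, h2, smul_eq_mul, mul_one]
  · intro u hu huv
    have : b ⟨u, hsub hu⟩ = u := Module.Basis.extend_apply_self ..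
    have h2 : b.coord ⟨v, hsub hv⟩ (b ⟨u, hsub hu⟩) = 0 := by simp [huv]
    rw [this] at h2
    rw [map_smul, h2, smul_zero]
  · exact fun h => absurd hv h

lemma totalDegree_aeval_le {m : ℕ} (p : MvPolynomial (Fin n) ℝ) {d : ℕ} (hp : p.totalDegree ≤ d)
    (q : Fin n → MvPolynomial (Fin m) ℝ) (hq : ∀ a, (q a).totalDegree ≤ 1) :
    (aeval q p).totalDegree ≤ d := by
  rw [aeval_def, eval₂_eq]
  refine totalDegree_finsetSum_le fun α hα => (totalDegree_mul _ _).trans ?_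
  rw [algebraMap_eq, totalDegree_C, zero_add]
  refine (totalDegree_finsetProd _ _).trans (le_trans ?_ ((le_totalDegree hα).trans hp))
  refine Finset.sum_le_sum fun a _ => (totalDegree_pow _ _).trans ?_
  simpa using Nat.mul_le_mul_left (α a) (hq a)

/-- On a simplex with a vertex at the origin, the Bernstein sums of degree `d` are polynomials of
total degree at most `d`. -/
lemma exists_polynomial_eq_bernsteinSum {s : Finset (Fin n → ℝ)} (h0 : 0 ∈ s)
    (hs : LinearIndepOn ℝ id (↑(s.erase 0) : Set (Fin n → ℝ))) (d : ℕ)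
    (c : ((Fin n → ℝ) → ℕ) → ℝ) :
    ∃ p : MvPolynomial (Fin n) ℝ, p.totalDegree ≤ d ∧
      ∀ w : (Fin n → ℝ) → ℝ, ∑ v ∈ s, w v = 1 →
        eval (∑ v ∈ s, w v • v) p = bernsteinSum s d c w := by
  obtain ⟨l, hl⟩ := exists_dual_family hs
  -- The barycentric coordinates as affine polynomials: since the origin adds nothing to the point,
  -- those of the nonzero vertices are linear functionals, and that of the origin is the complement
  -- to `1`.
  let q : (Fin n → ℝ) → MvPolynomial (Fin n) ℝ :=
    fun v => if v = 0 then 1 - ∑ u ∈ s.erase 0, dualPoly (l u) else dualPoly (l v)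
  have hqd : ∀ v, (q v).totalDegree ≤ 1 := by
    intro v
    simp only [q]
    split_ifs
    · refine (totalDegree_sub _ _).trans (max_le (by simp) ?_)
      exact totalDegree_finsetSum_le fun u _ => totalDegree_dualPoly_le _
    · exact totalDegree_dualPoly_le _
  refine ⟨∑ α ∈ s.piAntidiag d, C (c α * Nat.multinomial s α) * ∏ v ∈ s, q v ^ α v, ?_, ?_⟩
  · refine totalDegree_finsetSum_le fun α hα => (totalDegree_mul _ _).trans ?_
    rw [totalDegree_C, zero_add]
    refine (totalDegree_finsetProd _ _).trans (le_trans ?_ (Finset.mem_piAntidiag.1 hα).1.le)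
    refine Finset.sum_le_sum fun v _ => (totalDegree_pow _ _).trans ?_
    simpa using Nat.mul_le_mul_left (α v) (hqd v)
  · intro w hw
    have hsum : ∑ v ∈ s, w v • v = ∑ v ∈ s.erase 0, w v • v := by
      rw [← Finset.add_sum_erase s _ h0, smul_zero, zero_add]
    have hq : ∀ v ∈ s, eval (∑ v ∈ s, w v • v) (q v) = w v := by
      intro v hv
      simp only [q]
      split_ifs with hv0
      · have h1 : ∀ u ∈ s.erase 0, eval (∑ v ∈ s, w v • v) (dualPoly (l u)) = w u :=
          fun u hu => by rw [hsum, eval_dualPoly, hl u hu]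
        rw [map_sub, map_one, map_sum, Finset.sum_congr rfl h1, hv0, ← hw,
          ← Finset.add_sum_erase s _ h0]
        ring
      · rw [hsum, eval_dualPoly, hl v (Finset.mem_erase.2 ⟨hv0, hv⟩)]
    rw [map_sum, bernsteinSum]
    refine Finset.sum_congr rfl fun α _ => ?_
    rw [map_mul, eval_C, map_prod, mul_assoc]
    congr 2
    exact Finset.prod_congr rfl fun v hv => by rw [map_pow, hq v hv]

end Polynomial

/-! ### Fans: Bernstein–Bézier coefficients and minimal determining sets -/

section Fan

variable {n : ℕ}

/-- A finite partition whose maximal simplices all have a vertex at the origin, and such that a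
point of the cones over the maximal simplices has only one conical representation. -/
structure IsFan (K : Set (Finset (Fin n → ℝ))) : Prop where
  finite : K.Finite
  nonempty : K.Nonempty
  zero_mem : ∀ s ∈ maximalFaces K, (0 : Fin n → ℝ) ∈ s
  eq_of_sum_eq : ∀ s ∈ maximalFaces K, ∀ s' ∈ maximalFaces K, ∀ w w' : (Fin n → ℝ) → ℝ,
    (∀ v, 0 ≤ w v) → (∀ v, 0 ≤ w' v) → (∀ v, v ∉ s → w v = 0) → (∀ v, v ∉ s' → w' v = 0) →
    ∑ v ∈ s, w v • v = ∑ v ∈ s', w' v • v → ∀ v, v ≠ 0 → w v = w' v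

variable {K : Set (Finset (Fin n → ℝ))} {r d : ℕ} {F : (Fin n → ℝ) → ℝ}

lemma exists_maximalFace_of_finite (hK : K.Finite) {s : Finset (Fin n → ℝ)} (hs : s ∈ K) :
    ∃ t ∈ maximalFaces K, s ⊆ t := by
  obtain ⟨t, hst, ht⟩ := hK.exists_le_maximal hs
  exact ⟨t, ⟨ht.1, fun u hu htu => le_antisymm htu (ht.2 hu htu)⟩, hst⟩

lemma IsFan.exists_maximalFace (hK : IsFan K) : ∃ s, s ∈ maximalFaces K := by
  obtain ⟨s, hs⟩ := hK.nonempty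
  obtain ⟨t, ht, -⟩ := exists_maximalFace_of_finite hK.finite hs
  exact ⟨t, ht⟩

lemma mem_convexHull_iff_exists_isWeight {s : Finset (Fin n → ℝ)} {x : Fin n → ℝ} :
    x ∈ convexHull ℝ (s : Set (Fin n → ℝ)) ↔ ∃ w, IsWeight s w ∧ x = ∑ v ∈ s, w v • v := by
  rw [Finset.mem_convexHull']
  constructor
  · rintro ⟨w, hw, hw1, hx⟩
    refine ⟨fun v => if v ∈ s then w v else 0, ⟨fun v => ?_, fun v hv => if_neg hv, ?_⟩, ?_⟩
    · split_ifs with hv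
      exacts [hw v hv, le_rfl]
    · rw [← hw1]
      exact Finset.sum_congr rfl fun v hv => if_pos hv
    · rw [← hx]
      exact Finset.sum_congr rfl fun v hv => by simp only [if_pos hv]
  · rintro ⟨w, hw, rfl⟩
    exact ⟨w, fun v _ => hw.nonneg v, hw.sum_eq, rfl⟩

lemma sum_mem_domain {s : Finset (Fin n → ℝ)} (hs : s ∈ K) {w : (Fin n → ℝ) → ℝ}
    (hw : IsWeight s w) : ∑ v ∈ s, w v • v ∈ domain K :=
  Set.mem_biUnion hs (mem_convexHull_iff_exists_isWeight.2 ⟨w, hw, rfl⟩)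

lemma mem_domain_iff (hK : K.Finite) {x : Fin n → ℝ} :
    x ∈ domain K ↔ ∃ s ∈ maximalFaces K, ∃ w, IsWeight s w ∧ x = ∑ v ∈ s, w v • v := by
  constructor
  · intro hx
    obtain ⟨s, hs, hx⟩ := Set.mem_iUnion₂.1 hx
    obtain ⟨t, ht, hst⟩ := exists_maximalFace_of_finite hK hs
    exact ⟨t, ht, mem_convexHull_iff_exists_isWeight.1
      (convexHull_mono (Finset.coe_subset.2 hst) hx)⟩
  · rintro ⟨s, hs, w, hw, rfl⟩
    exact sum_mem_domain hs.1 hw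

/-- A sub-convex combination of vertices of a simplex containing the origin. -/
lemma sum_mem_convexHull_of_sum_le_one {s : Finset (Fin n → ℝ)} (h0 : (0 : Fin n → ℝ) ∈ s)
    {w : (Fin n → ℝ) → ℝ} (hw : ∀ v ∈ s, 0 ≤ w v) (hw1 : ∑ v ∈ s, w v ≤ 1) :
    ∑ v ∈ s, w v • v ∈ convexHull ℝ (s : Set (Fin n → ℝ)) := by
  rw [Finset.mem_convexHull']
  -- The missing mass is placed at the origin, where it does not move the point.
  refine ⟨fun v => w v + if v = 0 then 1 - ∑ v ∈ s, w v else 0, fun v hv => ?_, ?_, ?_⟩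
  · refine add_nonneg (hw v hv) ?_
    split_ifs
    exacts [by linarith, le_rfl]
  · rw [Finset.sum_add_distrib, Finset.sum_ite_eq' s, if_pos h0]
    ring
  · refine Finset.sum_congr rfl fun v _ => ?_
    by_cases hv : v = 0
    · simp [hv]
    · simp [hv]

lemma IsFan.smul_mem_domain (hK : IsFan K) {x : Fin n → ℝ} (hx : x ∈ domain K) {a : ℝ}
    (ha0 : 0 ≤ a) (ha1 : a ≤ 1) : a • x ∈ domain K := by
  obtain ⟨s, hs, w, hw, rfl⟩ := (mem_domain_iff hK.finite).1 hx
  refine Set.mem_biUnion hs.1 ?_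
  rw [Finset.smul_sum]
  simp only [smul_smul]
  refine sum_mem_convexHull_of_sum_le_one (hK.zero_mem s hs)
    (fun v _ => mul_nonneg ha0 (hw.nonneg v)) ?_
  rw [← Finset.mul_sum, hw.sum_eq, mul_one]
  exact ha1

lemma IsFan.zero_mem_domain (hK : IsFan K) : (0 : Fin n → ℝ) ∈ domain K := by
  obtain ⟨s, hs⟩ := hK.exists_maximalFace
  exact Set.mem_biUnion hs.1 (subset_convexHull _ _ (hK.zero_mem s hs))

/-- The positive and negative parts of a linear relation are two conical representations of one
point, hence equal. -/
lemma IsFan.linearIndepOn (hK : IsFan K) {s : Finset (Fin n → ℝ)} (hs : s ∈ maximalFaces K) :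
    LinearIndepOn ℝ id (↑(s.erase 0) : Set (Fin n → ℝ)) := by
  rw [linearIndepOn_finset_iff]
  intro g hg v hv
  let p : (Fin n → ℝ) → ℝ := fun v => if v ∈ s.erase 0 then max (g v) 0 else 0
  let m : (Fin n → ℝ) → ℝ := fun v => if v ∈ s.erase 0 then max (-g v) 0 else 0
  have h := hK.eq_of_sum_eq s hs s hs p m ?_ ?_ ?_ ?_ ?_ v (Finset.mem_erase.1 hv).1
  · simp only [p, m, if_pos hv] at h
    have := max_zero_sub_max_neg_zero_eq_self (g v)
    linarith
  · intro v; simp only [p]; split_ifs <;> simp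
  · intro v; simp only [m]; split_ifs <;> simp
  · intro v hv; exact if_neg fun h => hv (Finset.mem_of_mem_erase h)
  · intro v hv; exact if_neg fun h => hv (Finset.mem_of_mem_erase h)
  · rw [← sub_eq_zero, ← Finset.sum_sub_distrib, ← Finset.add_sum_erase s _ (hK.zero_mem s hs),
      smul_zero, smul_zero, sub_zero, zero_add]
    refine Eq.trans (Finset.sum_congr rfl fun v hv => ?_) hg
    simp only [p, m, if_pos hv, ← sub_smul, id]
    rw [max_zero_sub_max_neg_zero_eq_self]

/-- `F` restricts to a spline on the domain of `K`. -/
def IsSpline (K : Set (Finset (Fin n → ℝ))) (r d : ℕ) (F : (Fin n → ℝ) → ℝ) : Prop :=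
  ContDiffOn ℝ r F (domain K) ∧ ∀ s ∈ maximalFaces K, ∃ p : MvPolynomial (Fin n) ℝ,
    p.totalDegree ≤ d ∧ ∀ x ∈ convexHull ℝ (s : Set (Fin n → ℝ)), F x = eval x p

lemma IsSpline.restrict_mem (hF : IsSpline K r d F) :
    (fun x : domain K => F x) ∈ splineSpace K r d := ⟨F, fun _ => rfl, hF⟩

/-- `c` gives Bernstein–Bézier coefficients of the restriction of `F` to the domain of `K`. -/
def HasBForm (K : Set (Finset (Fin n → ℝ))) (d : ℕ) (F c : (Fin n → ℝ) → ℝ) : Prop :=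
  ∀ s ∈ maximalFaces K, ∀ w, IsWeight s w →
    F (∑ v ∈ s, w v • v) = bernsteinSum s d (fun α => c (domainPoint s d α)) w

/-- Truncating a weight to be zero off the simplex changes neither the point nor the Bernstein sum,
so it suffices to test weights of type `IsWeight`. -/
lemma isBForm_iff_hasBForm {f : domain K → ℝ} (hF : ∀ x : domain K, F x = f x)
    {c : (Fin n → ℝ) → ℝ} : IsBForm K d f c ↔ HasBForm K d F c := by
  constructor
  · intro h s hs w hw
    have := h s hs w (fun v _ => hw.nonneg v) hw.sum_eq ⟨_, sum_mem_domain hs.1 hw⟩ rfl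
    rw [← hF] at this
    exact this
  · intro h s hs w hw hw1 x hx
    have hm : IsWeight s (fun v => if v ∈ s then w v else 0) := by
      refine ⟨fun v => ?_, fun v hv => if_neg hv, ?_⟩
      · split_ifs with hv
        exacts [hw v hv, le_rfl]
      · rw [← hw1]
        exact Finset.sum_congr rfl fun v hv => if_pos hv
    have h1 := h s hs _ hm
    have h2 : (x : Fin n → ℝ) = ∑ v ∈ s, (if v ∈ s then w v else 0) • v := by
      rw [hx]
      exact Finset.sum_congr rfl fun v hv => by rw [if_pos hv]
    rw [← hF, h2, h1]
    exact bernsteinSum_congr (fun _ _ => rfl) fun v hv => if_pos hv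

lemma HasBForm.unique (hK : IsFan K) {c c' : (Fin n → ℝ) → ℝ} (h : HasBForm K d F c)
    (h' : HasBForm K d F c') : ∀ ξ ∈ domainPoints K d, c ξ = c' ξ := by
  rintro ξ ⟨s, hs, α, hα, rfl⟩
  refine bernsteinSum_injective ⟨0, hK.zero_mem s hs⟩
    (c := fun α => c (domainPoint s d α)) (c' := fun α => c' (domainPoint s d α)) ?_ α hα
  intro w hw
  rw [← h s hs w hw, ← h' s hs w hw]

lemma HasBForm.eq_zero (hK : K.Finite) {c : (Fin n → ℝ) → ℝ} (h : HasBForm K d F c)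
    (hc : ∀ ξ ∈ domainPoints K d, c ξ = 0) : ∀ x ∈ domain K, F x = 0 := by
  intro x hx
  obtain ⟨s, hs, w, hw, rfl⟩ := (mem_domain_iff hK).1 hx
  rw [h s hs w hw]
  exact Finset.sum_eq_zero fun α hα => by simp only [hc _ ⟨s, hs, α, hα, rfl⟩, zero_mul]

/-- Domain points of a fan determine their indices. -/
lemma IsFan.eq_of_domainPoint_eq (hK : IsFan K) {s s' : Finset (Fin n → ℝ)}
    (hs : s ∈ maximalFaces K) (hs' : s' ∈ maximalFaces K) {α α' : (Fin n → ℝ) → ℕ}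
    (hα : α ∈ s.piAntidiag d) (hα' : α' ∈ s'.piAntidiag d)
    (h : domainPoint s d α = domainPoint s' d α') : α = α' := by
  rcases Nat.eq_zero_or_pos d with rfl | hd
  · rw [Finset.piAntidiag_zero, Finset.mem_singleton] at hα hα'
    rw [hα, hα']
  rw [Finset.mem_piAntidiag] at hα hα'
  have hd' : (d : ℝ)⁻¹ ≠ 0 := by positivity
  have h1 := smul_right_injective _ hd' h
  have h2 : ∀ v, v ≠ 0 → α v = α' v := by
    intro v hv
    have := hK.eq_of_sum_eq s hs s' hs' (fun v => α v) (fun v => α' v) (fun v => by positivity)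
      (fun v => by positivity) (fun v hv => by rw [not_imp_comm.1 (hα.2 v) hv, Nat.cast_zero])
      (fun v hv => by rw [not_imp_comm.1 (hα'.2 v) hv, Nat.cast_zero]) h1 v hv
    exact_mod_cast this
  -- The point does not see the index of the origin; that index is recovered from the total `d`.
  have h3 : ∑ v ∈ s.erase 0, α v = ∑ v ∈ s'.erase 0, α' v := by
    refine Finset.sum_congr_of_eq_on_inter ?_ ?_ ?_
    · intro v hv hv'
      have hv0 := (Finset.mem_erase.1 hv).1
      rw [h2 v hv0]
      exact not_imp_comm.1 (hα'.2 v) fun h => hv' (Finset.mem_erase.2 ⟨hv0, h⟩)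
    · intro v hv hv'
      have hv0 := (Finset.mem_erase.1 hv).1
      rw [← h2 v hv0]
      exact not_imp_comm.1 (hα.2 v) fun h => hv' (Finset.mem_erase.2 ⟨hv0, h⟩)
    · exact fun v hv _ => h2 v (Finset.mem_erase.1 hv).1
  ext v
  by_cases hv : v = 0
  · have h4 := hα.1.trans hα'.1.symm
    rw [← Finset.add_sum_erase s _ (hK.zero_mem s hs),
      ← Finset.add_sum_erase s' _ (hK.zero_mem s' hs'), h3] at h4
    rw [hv]
    exact add_right_cancel h4
  · exact h2 v hv

/-- The coefficients on separate simplices must agree at shared domain points. Such a point has the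
same index in both simplices, so the index is supported on the common face. Both forms represent `F`
there, and Bernstein coefficients on a face are unique. -/
lemma IsFan.exists_hasBForm (hK : IsFan K) (hF : IsSpline K r d F) : ∃ c, HasBForm K d F c := by
  classical
  have hex : ∀ s : maximalFaces K, ∃ c : ((Fin n → ℝ) → ℕ) → ℝ, ∀ w, IsWeight s.1 w →
      F (∑ v ∈ s.1, w v • v) = bernsteinSum s.1 d c w := by
    rintro ⟨s, hs⟩
    obtain ⟨p, hp, hpF⟩ := hF.2 s hs
    obtain ⟨c, hc⟩ := exists_bernsteinSum_eq p hp s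
    refine ⟨c, fun w hw => ?_⟩
    rw [hpF _ (mem_convexHull_iff_exists_isWeight.2 ⟨w, hw, rfl⟩), hc w hw.sum_eq]
  choose C hC using hex
  -- At each domain point a simplex and an index are chosen arbitrarily; the rest of the proof shows
  -- independence of the choice.
  let c : (Fin n → ℝ) → ℝ := fun ξ =>
    if h : ∃ sα : maximalFaces K × ((Fin n → ℝ) → ℕ),
      sα.2 ∈ sα.1.1.piAntidiag d ∧ ξ = domainPoint sα.1.1 d sα.2 then C h.choose.1 h.choose.2 else 0
  refine ⟨c, fun s hs w hw => ?_⟩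
  rw [hC ⟨s, hs⟩ w hw]
  refine bernsteinSum_congr (fun α hα => ?_) fun _ _ => rfl
  have h : ∃ sα : maximalFaces K × ((Fin n → ℝ) → ℕ), sα.2 ∈ sα.1.1.piAntidiag d ∧
      domainPoint s d α = domainPoint sα.1.1 d sα.2 := ⟨(⟨s, hs⟩, α), hα, rfl⟩
  have hc : c (domainPoint s d α) = C h.choose.1 h.choose.2 := dif_pos h
  rw [hc]
  obtain ⟨h1, h2⟩ := h.choose_spec
  set s' := h.choose.1
  set α' := h.choose.2
  have hαα' : α = α' := hK.eq_of_domainPoint_eq hs s'.2 hα h1 h2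
  rw [← hαα'] at h1 ⊢
  have hne : (s ∩ s'.1).Nonempty :=
    ⟨0, Finset.mem_inter.2 ⟨hK.zero_mem s hs, hK.zero_mem _ s'.2⟩⟩
  refine bernsteinSum_injective hne (d := d) (c := C ⟨s, hs⟩) (c' := C s') ?_ α ?_
  · intro w hw
    have hext : ∀ t : Finset (Fin n → ℝ), s ∩ s'.1 ⊆ t →
        IsWeight t w ∧ ∑ v ∈ t, w v • v = ∑ v ∈ s ∩ s'.1, w v • v := by
      intro t ht
      refine ⟨⟨hw.nonneg, fun v hv => hw.eq_zero v fun h => hv (ht h), ?_⟩, ?_⟩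
      · rw [← hw.sum_eq]
        exact (Finset.sum_subset ht fun v _ hv => hw.eq_zero v hv).symm
      · exact (Finset.sum_subset ht fun v _ hv => by rw [hw.eq_zero v hv, zero_smul]).symm
    obtain ⟨hw1, he1⟩ := hext s Finset.inter_subset_left
    obtain ⟨hw2, he2⟩ := hext s'.1 Finset.inter_subset_right
    rw [← bernsteinSum_subset Finset.inter_subset_left hw.eq_zero,
      ← bernsteinSum_subset Finset.inter_subset_right hw.eq_zero, ← hC ⟨s, hs⟩ w hw1,
      ← hC s' w hw2, he1, he2]
  · rw [Finset.mem_piAntidiag] at hα h1 ⊢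
    have hsupp : ∀ v, α v ≠ 0 → v ∈ s ∩ s'.1 :=
      fun v hv => Finset.mem_inter.2 ⟨hα.2 v hv, h1.2 v hv⟩
    refine ⟨?_, hsupp⟩
    rw [← hα.1]
    exact Finset.sum_subset Finset.inter_subset_left fun v _ hv => not_imp_comm.1 (hsupp v) hv

lemma finite_domainPoints (hK : K.Finite) : (domainPoints K d).Finite := by
  have : domainPoints K d ⊆ ⋃ s ∈ K, (domainPoint s d) '' (s.piAntidiag d : Set _) := by
    rintro ξ ⟨s, hs, α, hα, rfl⟩
    exact Set.mem_biUnion hs.1 ⟨α, hα, rfl⟩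
  exact (hK.biUnion fun s _ => (Finset.finite_toSet _).image _).subset this

/-- The Bernstein–Bézier coefficients as a linear map. -/
lemma IsFan.exists_coeffMap (hK : IsFan K) (r d : ℕ) :
    ∃ B : splineSpace K r d →ₗ[ℝ] (domainPoints K d → ℝ),
      ∀ f c, IsBForm K d f.1 c → ∀ ξ, B f ξ = c ξ.1 := by
  have hex : ∀ f : splineSpace K r d, ∃ c, IsBForm K d f.1 c := by
    rintro ⟨f, F, hFf, hF⟩
    obtain ⟨c, hc⟩ := hK.exists_hasBForm hF
    exact ⟨c, (isBForm_iff_hasBForm hFf).2 hc⟩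
  have huniq : ∀ (f : domain K → ℝ) c c', IsBForm K d f c → IsBForm K d f c' →
      ∀ ξ ∈ domainPoints K d, c ξ = c' ξ := by
    intro f c c' hc hc'
    classical
    -- `HasBForm` only looks at values on the domain, so any extension of `f` serves.
    let F : (Fin n → ℝ) → ℝ := fun x => if h : x ∈ domain K then f ⟨x, h⟩ else 0
    have hF : ∀ x : domain K, F x = f x := fun x => dif_pos x.2
    exact ((isBForm_iff_hasBForm hF).1 hc).unique hK ((isBForm_iff_hasBForm hF).1 hc')
  choose c hc using hex
  refine ⟨⟨⟨fun f ξ => c f ξ.1, fun f g => ?_⟩, fun a f => ?_⟩,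
    fun f c' h ξ => huniq _ _ _ (hc f) h _ ξ.2⟩
  · ext ξ
    refine huniq _ _ (fun ξ => c f ξ + c g ξ) (hc (f + g)) ?_ _ ξ.2
    intro s hs w hw hw1 x hx
    have h1 := hc f s hs w hw hw1 x hx
    have h2 := hc g s hs w hw hw1 x hx
    simp only [add_mul, Finset.sum_add_distrib]
    rw [← h1, ← h2]
    rfl
  · ext ξ
    refine huniq _ _ (fun ξ => a * c f ξ) (hc (a • f)) ?_ _ ξ.2
    intro s hs w hw hw1 x hx
    have h1 := hc f s hs w hw hw1 x hx
    simp only [mul_assoc]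
    rw [← Finset.mul_sum, ← h1]
    rfl

lemma IsBForm.eq_zero (hK : K.Finite) {f : domain K → ℝ} {c : (Fin n → ℝ) → ℝ}
    (h : IsBForm K d f c) (hc : ∀ ξ ∈ domainPoints K d, c ξ = 0) : f = 0 := by
  classical
  let F : (Fin n → ℝ) → ℝ := fun x => if h : x ∈ domain K then f ⟨x, h⟩ else 0
  have hF : ∀ x : domain K, F x = f x := fun x => dif_pos x.2
  funext x
  rw [← hF]
  exact ((isBForm_iff_hasBForm hF).1 h).eq_zero hK hc x.1 x.2

lemma IsFan.exists_isBForm (hK : IsFan K) {f : domain K → ℝ} (hf : f ∈ splineSpace K r d) :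
    ∃ c, IsBForm K d f c := by
  obtain ⟨F, hFf, hF⟩ := hf
  obtain ⟨c, hc⟩ := hK.exists_hasBForm hF
  exact ⟨c, (isBForm_iff_hasBForm hFf).2 hc⟩

lemma IsFan.finite_splineSpace (hK : IsFan K) (r d : ℕ) :
    Module.Finite ℝ (splineSpace K r d) := by
  obtain ⟨B, hB⟩ := hK.exists_coeffMap r d
  have := (finite_domainPoints (d := d) hK.finite).to_subtype
  refine Module.Finite.of_injective B ((injective_iff_map_eq_zero B).2 fun f hf => ?_)
  obtain ⟨c, hc⟩ := hK.exists_isBForm f.2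
  refine Subtype.ext (hc.eq_zero hK.finite fun ξ hξ => ?_)
  rw [← hB f c hc ⟨ξ, hξ⟩, hf]
  rfl

lemma IsFan.finite_of_isDeterminingSet (hK : IsFan K) {M : Set (Fin n → ℝ)}
    (hM : IsDeterminingSet K r d M) : M.Finite :=
  (finite_domainPoints hK.finite).subset hM.1

/-- Being determining says that reading off the coefficients at `M` is an injective linear map into
`M → ℝ`. -/
lemma IsFan.finrank_le_encard (hK : IsFan K) {M : Set (Fin n → ℝ)}
    (hM : IsDeterminingSet K r d M) :
    (Module.finrank ℝ (splineSpace K r d) : ℕ∞) ≤ M.encard := by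
  obtain ⟨B, hB⟩ := hK.exists_coeffMap r d
  have hfin := hK.finite_of_isDeterminingSet hM
  have := hfin.fintype
  let R : splineSpace K r d →ₗ[ℝ] (M → ℝ) :=
    (LinearMap.funLeft ℝ ℝ fun ξ : M => (⟨ξ.1, hM.1 ξ.2⟩ : domainPoints K d)) ∘ₗ B
  have hR : Function.Injective R := by
    refine (injective_iff_map_eq_zero R).2 fun f hf => ?_
    obtain ⟨c, hc⟩ := hK.exists_isBForm f.2
    refine Subtype.ext (hM.2 f.1 f.2 c hc fun ξ hξ => ?_)
    rw [← hB f c hc ⟨ξ, hM.1 hξ⟩]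
    exact congrFun hf ⟨ξ, hξ⟩
  have h1 := LinearMap.finrank_le_finrank_of_injective hR
  rw [Module.finrank_fintype_fun_eq_card] at h1
  rw [Set.encard_eq_coe_toFinset_card, Set.toFinset_card]
  exact_mod_cast h1

/-- Among the coefficient functionals, choose a linearly independent subfamily with the same span;
there are at most as many as the dimension of the dual, and together they control all coefficients.
-/
lemma IsFan.exists_isDeterminingSet_encard_le (hK : IsFan K) (r d : ℕ) :
    ∃ N, IsDeterminingSet K r d N ∧ N.encard ≤ Module.finrank ℝ (splineSpace K r d) := by
  obtain ⟨B, hB⟩ := hK.exists_coeffMap r d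
  have := hK.finite_splineSpace r d
  let φ : domainPoints K d → Module.Dual ℝ (splineSpace K r d) :=
    fun ξ => (LinearMap.proj ξ) ∘ₗ B
  obtain ⟨κ, a, ha, hspan, hli⟩ := exists_linearIndependent' ℝ φ
  have hκ := hli.finite
  have := Fintype.ofFinite κ
  have hinj : Function.Injective fun k => (a k).1 := Subtype.val_injective.comp ha
  refine ⟨Set.range fun k => (a k).1, ⟨?_, fun f hf c hc h0 => ?_⟩, ?_⟩
  · rintro _ ⟨k, rfl⟩
    exact (a k).2
  · have hle : Submodule.span ℝ (Set.range φ) ≤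
        LinearMap.ker (Module.Dual.eval ℝ (splineSpace K r d) ⟨f, hf⟩) := by
      rw [← hspan, Submodule.span_le]
      rintro _ ⟨k, rfl⟩
      have h1 : B ⟨f, hf⟩ (a k) = 0 := by
        rw [hB ⟨f, hf⟩ c hc]
        exact h0 _ ⟨k, rfl⟩
      simpa [φ] using h1
    refine hc.eq_zero hK.finite fun ξ hξ => ?_
    have h2 := hle (Submodule.subset_span ⟨⟨ξ, hξ⟩, rfl⟩)
    rw [← hB ⟨f, hf⟩ c hc ⟨ξ, hξ⟩]
    simpa [φ] using h2
  · have h1 := hli.fintype_card_le_finrank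
    rw [Subspace.dual_finrank_eq] at h1
    rw [← Set.image_univ, hinj.encard_image, Set.encard_univ, ENat.card_eq_coe_fintype_card]
    exact_mod_cast h1

/-- Minimal determining sets have as many elements as the dimension of the spline space. -/
lemma IsFan.isMinimalDeterminingSet_iff (hK : IsFan K) {M : Set (Fin n → ℝ)} :
    IsMinimalDeterminingSet K r d M ↔
      IsDeterminingSet K r d M ∧ M.encard = Module.finrank ℝ (splineSpace K r d) := by
  constructor
  · rintro ⟨h, hmin⟩
    obtain ⟨N, hN, hle⟩ := hK.exists_isDeterminingSet_encard_le r d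
    exact ⟨h, le_antisymm ((hmin N hN).trans hle) (hK.finrank_le_encard h)⟩
  · rintro ⟨h, he⟩
    exact ⟨h, fun N hN => he.le.trans (hK.finrank_le_encard hN)⟩

end Fan

/-! ### Scaling a fan, including the collapse to the origin -/

section Scale

lemma eval_aeval_eq {n m : ℕ} (q : Fin n → MvPolynomial (Fin m) ℝ) (p : MvPolynomial (Fin n) ℝ)
    (x : Fin m → ℝ) : eval x (aeval q p) = eval (fun a => eval x (q a)) p := by
  have := comp_aeval_apply (f := q) (aeval x : MvPolynomial (Fin m) ℝ →ₐ[ℝ] ℝ) p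
  simpa [coe_aeval_eq_eval] using this

lemma bernsteinSum_zero {X : Type*} [DecidableEq X] (s : Finset X) (c : (X → ℕ) → ℝ)
    (w : X → ℝ) : bernsteinSum s 0 c w = c 0 := by
  simp [bernsteinSum, Nat.multinomial]

lemma bernsteinSum_image {X Y : Type*} [DecidableEq X] [DecidableEq Y] {φ : X → Y}
    (hφ : Function.Injective φ) (s : Finset X) (d : ℕ) (c : (Y → ℕ) → ℝ) (w : Y → ℝ) :
    bernsteinSum (s.image φ) d c w =
      bernsteinSum s d (fun α => c (Function.extend φ α 0)) (fun x => w (φ x)) := by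
  unfold bernsteinSum
  refine Finset.sum_bij' (fun β _ x => β (φ x)) (fun α _ => Function.extend φ α 0) ?_ ?_ ?_ ?_ ?_
  · intro β hβ
    rw [Finset.mem_piAntidiag, Finset.sum_image hφ.injOn] at hβ
    rw [Finset.mem_piAntidiag]
    refine ⟨hβ.1, fun x hx => ?_⟩
    simpa [hφ.eq_iff] using hβ.2 _ hx
  · intro α hα
    rw [Finset.mem_piAntidiag] at hα
    rw [Finset.mem_piAntidiag, Finset.sum_image hφ.injOn]
    simp only [hφ.extend_apply]
    refine ⟨hα.1, fun y hy => ?_⟩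
    by_cases h : ∃ x, φ x = y
    · obtain ⟨x, rfl⟩ := h
      rw [hφ.extend_apply] at hy
      exact Finset.mem_image_of_mem _ (hα.2 x hy)
    · rw [Function.extend_apply' _ _ _ h] at hy
      exact absurd rfl hy
  · intro β hβ
    rw [Finset.mem_piAntidiag] at hβ
    ext y
    by_cases h : ∃ x, φ x = y
    · obtain ⟨x, rfl⟩ := h
      rw [hφ.extend_apply]
    · rw [Function.extend_apply' _ _ _ h]
      by_contra hne
      obtain ⟨x, -, hx⟩ := Finset.mem_image.1 (hβ.2 y (Ne.symm hne))
      exact h ⟨x, hx⟩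
  · intro α _
    ext x
    exact hφ.extend_apply ..
  · intro β hβ
    rw [Finset.mem_piAntidiag] at hβ
    have h1 : Function.extend φ (fun x => β (φ x)) 0 = β := by
      ext y
      by_cases h : ∃ x, φ x = y
      · obtain ⟨x, rfl⟩ := h
        rw [hφ.extend_apply]
      · rw [Function.extend_apply' _ _ _ h]
        by_contra hne
        obtain ⟨x, -, hx⟩ := Finset.mem_image.1 (hβ.2 y (Ne.symm hne))
        exact h ⟨x, hx⟩
    beta_reduce
    rw [h1, Finset.prod_image hφ.injOn]
    congr 2
    simp only [Nat.multinomial]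
    rw [Finset.sum_image hφ.injOn, Finset.prod_image hφ.injOn]

variable {n : ℕ} {K : Set (Finset (Fin n → ℝ))} {r d : ℕ} {F : (Fin n → ℝ) → ℝ} {a : ℝ}

lemma finite_scale (hK : K.Finite) (a : ℝ) : (scale a K).Finite := hK.image _

lemma exists_of_mem_maximalFaces_scale (hK : K.Finite) {s : Finset (Fin n → ℝ)}
    (hs : s ∈ maximalFaces (scale a K)) :
    ∃ ω ∈ maximalFaces K, s = ω.image (fun x => a • x) := by
  obtain ⟨⟨t, ht, rfl⟩, hmax⟩ := hs
  obtain ⟨ω, hω, htω⟩ := exists_maximalFace_of_finite hK ht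
  exact ⟨ω, hω, hmax _ ⟨ω, hω.1, rfl⟩ (Finset.image_subset_image htω)⟩

lemma scale_inv_scale (ha : a ≠ 0) : scale a⁻¹ (scale a K) = K := by
  have : ∀ s : Finset (Fin n → ℝ), (s.image (fun x => a • x)).image (fun x => a⁻¹ • x) = s := by
    intro s
    rw [Finset.image_image]
    have : ((fun x : Fin n → ℝ => a⁻¹ • x) ∘ fun x => a • x) = id := by
      ext x
      simp [ha]
    rw [this, Finset.image_id]
  simp only [scale, Set.image_image, this, Set.image_id']

lemma smul_mem_convexHull_image {s : Finset (Fin n → ℝ)} (a : ℝ) {x : Fin n → ℝ}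
    (hx : x ∈ convexHull ℝ (s : Set (Fin n → ℝ))) :
    a • x ∈ convexHull ℝ (↑(s.image fun x => a • x) : Set (Fin n → ℝ)) := by
  rw [Finset.coe_image, Set.image_smul, convexHull_smul]
  exact Set.smul_mem_smul_set hx

lemma smul_mem_domain_scale (a : ℝ) {x : Fin n → ℝ} (hx : x ∈ domain K) :
    a • x ∈ domain (scale a K) := by
  obtain ⟨s, hs, hx⟩ := Set.mem_iUnion₂.1 hx
  exact Set.mem_biUnion ⟨s, hs, rfl⟩ (smul_mem_convexHull_image a hx)

lemma exists_of_mem_domain_scale {y : Fin n → ℝ} (hy : y ∈ domain (scale a K)) :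
    ∃ x ∈ domain K, y = a • x := by
  obtain ⟨_, ⟨s, hs, rfl⟩, hy⟩ := Set.mem_iUnion₂.1 hy
  rw [Finset.coe_image, Set.image_smul, convexHull_smul] at hy
  obtain ⟨x, hx, rfl⟩ := hy
  exact ⟨x, Set.mem_biUnion hs hx, rfl⟩

lemma IsFan.scale (hK : IsFan K) (a : ℝ) : IsFan (scale a K) := by
  refine ⟨finite_scale hK.finite a, hK.nonempty.image _, fun s hs => ?_, ?_⟩
  · obtain ⟨ω, hω, rfl⟩ := exists_of_mem_maximalFaces_scale hK.finite hs
    exact Finset.mem_image.2 ⟨0, hK.zero_mem ω hω, smul_zero a⟩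
  · intro s hs s' hs' w w' hw hw' hws hws' he v hv
    obtain ⟨ω, hω, rfl⟩ := exists_of_mem_maximalFaces_scale hK.finite hs
    obtain ⟨ω', hω', rfl⟩ := exists_of_mem_maximalFaces_scale hK.finite hs'
    -- For `a = 0` every simplex collapses onto the origin, so both weights vanish at `v ≠ 0`.
    rcases eq_or_ne a 0 with rfl | ha
    · rw [hws v, hws' v]
      all_goals
        simp only [zero_smul, Finset.mem_image, not_exists, not_and]
        exact fun _ _ h => hv h.symm
    · have hinj : Function.Injective fun x : Fin n → ℝ => a • x := smul_right_injective _ ha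
      rw [Finset.sum_image hinj.injOn, Finset.sum_image hinj.injOn] at he
      have he' : a • ∑ u ∈ ω, w (a • u) • u = a • ∑ u ∈ ω', w' (a • u) • u := by
        rw [Finset.smul_sum, Finset.smul_sum]
        simpa only [smul_comm a] using he
      have h := hK.eq_of_sum_eq ω hω ω' hω' (fun u => w (a • u)) (fun u => w' (a • u))
        (fun u => hw _) (fun u => hw' _)
        (fun u hu => hws _ fun h => hu (by simpa [ha] using h))
        (fun u hu => hws' _ fun h => hu (by simpa [ha] using h)) (hinj he') (a⁻¹ • v)
        (smul_ne_zero (inv_ne_zero ha) hv)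
      simpa [smul_smul, ha] using h

lemma IsSpline.comp_smul (hK : K.Finite) (hF : IsSpline (scale a K) r d F) :
    IsSpline K r d (fun x => F (a • x)) := by
  refine ⟨hF.1.comp (contDiff_const_smul a).contDiffOn fun x hx => smul_mem_domain_scale a hx,
    fun s hs => ?_⟩
  obtain ⟨t, ht, hst⟩ := exists_maximalFace_of_finite (finite_scale hK a) ⟨s, hs.1, rfl⟩
  obtain ⟨p, hp, hpF⟩ := hF.2 t ht
  refine ⟨aeval (fun b => C a * X b) p, totalDegree_aeval_le p hp _ fun b => ?_, fun x hx => ?_⟩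
  · refine (totalDegree_mul _ _).trans ?_
    simp
  · beta_reduce
    rw [hpF _ (convexHull_mono (Finset.coe_subset.2 hst) (smul_mem_convexHull_image a hx)),
      eval_aeval_eq]
    have : a • x = fun b => eval x (C a * X b) := by ext b; simp
    rw [← this]

/-- Splines of degree `0` on a fan are constant. -/
lemma IsFan.eq_of_isSpline_zero (hK : IsFan K) (hF : IsSpline K r 0 F) {x : Fin n → ℝ}
    (hx : x ∈ domain K) : F x = F 0 := by
  obtain ⟨s, hs, w, hw, rfl⟩ := (mem_domain_iff hK.finite).1 hx
  obtain ⟨p, hp, hpF⟩ := hF.2 s hs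
  have hp' := totalDegree_eq_zero_iff_eq_C.1 (Nat.le_zero.1 hp)
  rw [hpF _ (mem_convexHull_iff_exists_isWeight.2 ⟨w, hw, rfl⟩),
    hpF 0 (subset_convexHull _ _ (hK.zero_mem s hs)), hp', eval_C, eval_C]

/-- For `a ≠ 0` precompose with `a⁻¹`. Factor `0` is allowed only in degree `0`, where splines on a
fan are constant and nothing is lost in the collapse. -/
lemma IsFan.exists_isSpline_scale (hK : IsFan K) (had : a = 0 → d = 0) (hF : IsSpline K r d F) :
    ∃ G, IsSpline (BBSpline.scale a K) r d G ∧ ∀ x ∈ domain K, G (a • x) = F x := by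
  rcases eq_or_ne a 0 with ha | ha
  · obtain rfl := had ha
    exact ⟨fun _ => F 0, ⟨contDiffOn_const, fun _ _ => ⟨C (F 0), by simp, by simp⟩⟩,
      fun x hx => (hK.eq_of_isSpline_zero hF hx).symm⟩
  · refine ⟨fun x => F (a⁻¹ • x), IsSpline.comp_smul (finite_scale hK.finite a) ?_, fun x _ => ?_⟩
    · rwa [scale_inv_scale ha]
    · simp [smul_smul, ha]

lemma IsFan.finrank_splineSpace_scale (hK : IsFan K) (had : a = 0 → d = 0) :
    Module.finrank ℝ (splineSpace (BBSpline.scale a K) r d) =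
      Module.finrank ℝ (splineSpace K r d) := by
  let Φ : splineSpace (BBSpline.scale a K) r d →ₗ[ℝ] splineSpace K r d :=
    { toFun := fun f => ⟨fun x => f.1 ⟨a • x.1, smul_mem_domain_scale a x.2⟩, by
        obtain ⟨F, hFf, hF⟩ := f.2
        exact ⟨fun x => F (a • x), fun x => hFf ⟨a • x.1, smul_mem_domain_scale a x.2⟩,
          IsSpline.comp_smul hK.finite hF⟩⟩
      map_add' := fun _ _ => rfl
      map_smul' := fun _ _ => rfl }
  refine (LinearEquiv.ofBijective Φ ⟨?_, ?_⟩).finrank_eq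
  · refine (injective_iff_map_eq_zero Φ).2 fun f hf => Subtype.ext (funext fun y => ?_)
    obtain ⟨x, hx, hy⟩ := exists_of_mem_domain_scale y.2
    have h1 : y = ⟨a • x, smul_mem_domain_scale a hx⟩ := Subtype.ext hy
    rw [h1]
    exact congrFun (congrArg Subtype.val hf) ⟨x, hx⟩
  · rintro ⟨f, F, hFf, hF⟩
    obtain ⟨G, hG, hGF⟩ := hK.exists_isSpline_scale had hF
    refine ⟨⟨_, hG.restrict_mem⟩, Subtype.ext (funext fun x => ?_)⟩
    exact (hGF x x.2).trans (hFf x)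

lemma domainPoint_image {a : ℝ} (ha : a ≠ 0) (s : Finset (Fin n → ℝ)) (j : ℕ)
    (α : (Fin n → ℝ) → ℕ) :
    domainPoint (s.image fun x => a • x) j α =
      (a / j) • ∑ v ∈ s, (α (a • v) : ℝ) • v := by
  have hinj : Function.Injective fun x : Fin n → ℝ => a • x := smul_right_injective _ ha
  rw [domainPoint, Finset.sum_image hinj.injOn, div_eq_inv_mul, mul_smul, Finset.smul_sum (r := a)]
  simp only [smul_comm a]

/-- The factor `j / d` turns the normalization `1 / j` into `1 / d`. The indices have total `j` but
the point is normalized by `d`, ready to be completed by medial indices of total `d - j`. -/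
lemma exists_of_mem_domainPoints_scale (hK : IsFan K) {j : ℕ} (hj : j ≤ d) {ξ : Fin n → ℝ}
    (hξ : ξ ∈ domainPoints (scale ((j : ℝ) / d) K) j) :
    ∃ ω ∈ maximalFaces K, ∃ α ∈ ω.piAntidiag j, ξ = domainPoint ω d α := by
  obtain ⟨s, hs, α, hα, rfl⟩ := hξ
  obtain ⟨ω, hω, rfl⟩ := exists_of_mem_maximalFaces_scale hK.finite hs
  rcases Nat.eq_zero_or_pos j with rfl | hj0
  · refine ⟨ω, hω, 0, by simp, ?_⟩
    simp [domainPoint]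
  · have hj' : (j : ℝ) ≠ 0 := by positivity
    have hd' : (d : ℝ) ≠ 0 := by have := hj0.trans_le hj; positivity
    have ha : (j : ℝ) / d ≠ 0 := div_ne_zero hj' hd'
    have hinj : Function.Injective fun x : Fin n → ℝ => ((j : ℝ) / d) • x :=
      smul_right_injective _ ha
    rw [Finset.mem_piAntidiag, Finset.sum_image hinj.injOn] at hα
    refine ⟨ω, hω, fun v => α (((j : ℝ) / d) • v), ?_, ?_⟩
    · rw [Finset.mem_piAntidiag]
      refine ⟨hα.1, fun v hv => ?_⟩
      simpa [ha, hj', hd'] using hα.2 _ hv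
    · rw [domainPoint_image ha, domainPoint]
      congr 1
      field_simp

/-- Bernstein–Bézier coefficients on the scaled fan `(j/d) K`. -/
lemma IsFan.hasBForm_scale (hK : IsFan K) {j : ℕ} (hj : j ≤ d) {G c : (Fin n → ℝ) → ℝ}
    (hG : ∀ x ∈ domain K, G (((j : ℝ) / d) • x) = F x)
    (hF : ∀ ω ∈ maximalFaces K, ∀ w, IsWeight ω w →
      F (∑ v ∈ ω, w v • v) = bernsteinSum ω j (fun α => c (domainPoint ω d α)) w) :
    HasBForm (BBSpline.scale ((j : ℝ) / d) K) j G c := by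
  intro s hs w hw
  obtain ⟨ω, hω, rfl⟩ := exists_of_mem_maximalFaces_scale hK.finite hs
  -- For `j = 0` the scaled domain is the origin; the single coefficient is obtained by evaluating
  -- `F` at the vertex `0` of `ω`.
  rcases Nat.eq_zero_or_pos j with rfl | hj0
  · have h1 : ∑ v ∈ ω.image (fun x => (((0 : ℕ) : ℝ) / d) • x), w v • v = 0 := by
      refine Finset.sum_eq_zero fun v hv => ?_
      obtain ⟨u, -, rfl⟩ := Finset.mem_image.1 hv
      simp
    have h0 := hK.zero_mem ω hω
    have h2 := hG 0 hK.zero_mem_domain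
    have h3 := hF ω hω (fun v => if v = 0 then 1 else 0) ⟨fun v => ?_, fun v hv => ?_, ?_⟩
    · have h4 : ∑ v ∈ ω, (if v = 0 then (1 : ℝ) else 0) • v = 0 :=
        Finset.sum_eq_zero fun v _ => by split_ifs with h <;> simp [h]
      rw [h1, bernsteinSum_zero]
      rw [smul_zero] at h2
      rw [h4, bernsteinSum_zero] at h3
      rw [h2, h3]
      simp [domainPoint]
    · split_ifs <;> simp
    · exact if_neg fun h : v = 0 => hv (by rwa [h])
    · rw [Finset.sum_ite_eq' ω, if_pos h0]
  · have hj' : (j : ℝ) ≠ 0 := by positivity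
    have hd' : (d : ℝ) ≠ 0 := by have := hj0.trans_le hj; positivity
    have ha : (j : ℝ) / d ≠ 0 := div_ne_zero hj' hd'
    have hinj : Function.Injective fun x : Fin n → ℝ => ((j : ℝ) / d) • x :=
      smul_right_injective _ ha
    have hw' : IsWeight ω fun u => w (((j : ℝ) / d) • u) := by
      refine ⟨fun u => hw.nonneg _, fun u hu => hw.eq_zero _ fun h => hu ?_, ?_⟩
      · simpa [ha, hj', hd'] using h
      · rw [← hw.sum_eq, Finset.sum_image hinj.injOn]
    have h1 : ∑ v ∈ ω.image (fun x => ((j : ℝ) / d) • x), w v • v =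
        ((j : ℝ) / d) • ∑ u ∈ ω, w (((j : ℝ) / d) • u) • u := by
      rw [Finset.sum_image hinj.injOn, Finset.smul_sum]
      simp only [smul_comm ((j : ℝ) / d)]
    rw [h1, hG _ (sum_mem_domain hω.1 hw'), hF ω hω _ hw', bernsteinSum_image hinj]
    refine bernsteinSum_congr (fun α _ => ?_) fun _ _ => rfl
    rw [domainPoint_image ha, domainPoint]
    congr 2
    · field_simp
    · refine Finset.sum_congr rfl fun v _ => ?_
      congr 2
      exact (hinj.extend_apply α 0 v).symm

end Scale

/-! ### The projection and embedding as smooth linear maps -/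

section Projection

variable {i k : ℕ}

lemma proj_eq_funLeft (h : i ≤ k) (x : Fin k → ℝ) :
    proj h x = LinearMap.funLeft ℝ ℝ (Fin.castLE h) x := rfl

lemma proj_add (h : i ≤ k) (x y : Fin k → ℝ) : proj h (x + y) = proj h x + proj h y := rfl

lemma proj_sum_smul (h : i ≤ k) (s : Finset (Fin k → ℝ)) (w : (Fin k → ℝ) → ℝ) :
    proj h (∑ v ∈ s, w v • v) = ∑ v ∈ s, w v • proj h v := by
  simp only [proj_eq_funLeft, map_sum, map_smul]

/-- `embed` as a linear map. -/
def embedLin (i k : ℕ) : (Fin i → ℝ) →ₗ[ℝ] (Fin k → ℝ) where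
  toFun := embed k
  map_add' x y := by
    ext b
    simp only [embed, Pi.add_apply]
    split_ifs <;> simp
  map_smul' a x := by
    ext b
    simp only [embed, Pi.smul_apply, RingHom.id_apply]
    split_ifs <;> simp

lemma embed_eq_embedLin (x : Fin i → ℝ) : embed k x = embedLin i k x := rfl

lemma embed_zero : embed k (0 : Fin i → ℝ) = 0 := (embedLin i k).map_zero

lemma embed_smul (a : ℝ) (x : Fin i → ℝ) : embed k (a • x) = a • embed k x :=
  (embedLin i k).map_smul a x

lemma embed_sum_smul (s : Finset (Fin i → ℝ)) (w : (Fin i → ℝ) → ℝ) :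
    embed k (∑ v ∈ s, w v • v) = ∑ v ∈ s, w v • embed k v := by
  simp only [embed_eq_embedLin, map_sum, map_smul]

lemma proj_embed (h : i ≤ k) (x : Fin i → ℝ) : proj h (embed k x) = x := by
  ext a
  simp [proj, embed]

lemma embed_injective (h : i ≤ k) : Function.Injective (embed (i := i) k) :=
  Function.LeftInverse.injective (proj_embed h)

lemma contDiff_proj (h : i ≤ k) {m : WithTop ℕ∞} : ContDiff ℝ m (proj h) :=
  (LinearMap.toContinuousLinearMap (LinearMap.funLeft ℝ ℝ (Fin.castLE h))).contDiff

lemma contDiff_embed {m : WithTop ℕ∞} : ContDiff ℝ m (embed (i := i) k) :=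
  (LinearMap.toContinuousLinearMap (embedLin i k)).contDiff

end Projection

/-! ### The orange and its projection are fans -/

section Orange

variable {i k : ℕ}

lemma linearIndepOn_erase_zero {n : ℕ} {s : Finset (Fin n → ℝ)} (h0 : (0 : Fin n → ℝ) ∈ s)
    (hs : AffineIndependent ℝ ((↑) : s → Fin n → ℝ)) :
    LinearIndepOn ℝ id (↑(s.erase 0) : Set (Fin n → ℝ)) := by
  have h1 := (affineIndependent_set_iff_linearIndependent_vsub ℝ
    (s := (s : Set (Fin n → ℝ))) (Finset.mem_coe.2 h0)).1 hs
  have h2 : (fun p : Fin n → ℝ => p -ᵥ (0 : Fin n → ℝ)) '' (↑s \ {0}) = ↑(s.erase 0) := by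
    simp
  rw [h2] at h1
  exact h1

lemma eq_of_sum_smul_eq_of_linearIndepOn {V : Type*} [AddCommGroup V] [Module ℝ V] {T : Finset V}
    (hT : LinearIndepOn ℝ id (T : Set V)) {a b : V → ℝ}
    (h : ∑ v ∈ T, a v • v = ∑ v ∈ T, b v • v) : ∀ v ∈ T, a v = b v := by
  intro v hv
  obtain ⟨l, hl⟩ := exists_dual_family hT
  rw [← hl v hv a, h, hl v hv b]

/-- A finite simplicial complex all of whose facets contain the origin is a fan. -/
lemma isFan_faces (O : Geometry.SimplicialComplex ℝ (Fin k → ℝ)) (hfin : O.faces.Finite)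
    (hne : O.faces.Nonempty) (h0 : ∀ s ∈ O.facets, (0 : Fin k → ℝ) ∈ s) : IsFan O.faces := by
  refine ⟨hfin, hne, h0, ?_⟩
  intro s hs s' hs' w w' hw hw' hws hws' he v hv
  have hs0 := h0 s hs
  have hs0' := h0 s' hs'
  -- Dividing by `S` shrinks both conical combinations into the simplices themselves, the origin
  -- taking up the slack; the summand `1` only ensures `S > 0`.
  set S := ∑ v ∈ s, w v + ∑ v ∈ s', w' v + 1 with hS
  have hp : 0 ≤ ∑ v ∈ s, w v := Finset.sum_nonneg fun v _ => hw v
  have hp' : 0 ≤ ∑ v ∈ s', w' v := Finset.sum_nonneg fun v _ => hw' v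
  have hSpos : 0 < S := by positivity
  have hx : ∑ v ∈ s, (S⁻¹ * w v) • v ∈ convexHull ℝ (s : Set (Fin k → ℝ)) := by
    refine sum_mem_convexHull_of_sum_le_one hs0 (fun v _ => mul_nonneg (by positivity) (hw v)) ?_
    rw [← Finset.mul_sum, inv_mul_le_one₀ hSpos]
    linarith
  have hx' : ∑ v ∈ s', (S⁻¹ * w' v) • v ∈ convexHull ℝ (s' : Set (Fin k → ℝ)) := by
    refine sum_mem_convexHull_of_sum_le_one hs0' (fun v _ => mul_nonneg (by positivity) (hw' v)) ?_
    rw [← Finset.mul_sum, inv_mul_le_one₀ hSpos]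
    linarith
  have hxx' : ∑ v ∈ s, (S⁻¹ * w v) • v = ∑ v ∈ s', (S⁻¹ * w' v) • v := by
    simp only [mul_smul]
    rw [← Finset.smul_sum, ← Finset.smul_sum, he]
  have hmem := O.inter_subset_convexHull hs.1 hs'.1 ⟨hx, hxx' ▸ hx'⟩
  rw [← Finset.coe_inter, mem_convexHull_iff_exists_isWeight] at hmem
  obtain ⟨u, hu, hxu⟩ := hmem
  -- The point lies in the hull of `s ∩ s'` with weights `u`. Linear independence of the nonzero
  -- vertices of either simplex forces its weights, away from the origin, to be `S * u`.
  have key : ∀ t ∈ O.faces, (0 : Fin k → ℝ) ∈ t → s ∩ s' ⊆ t → ∀ b : (Fin k → ℝ) → ℝ,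
      (∀ v, v ∉ t → b v = 0) → ∑ v ∈ t, (S⁻¹ * b v) • v = ∑ v ∈ s ∩ s', u v • v →
      b v = S * u v := by
    intro t ht ht0 hst b hb hbu
    by_cases hvt : v ∈ t
    · have h1 : ∑ v ∈ s ∩ s', u v • v = ∑ v ∈ t, u v • v :=
        Finset.sum_subset hst fun v _ hv => by rw [hu.eq_zero v hv, zero_smul]
      rw [h1, ← Finset.add_sum_erase t _ ht0, ← Finset.add_sum_erase t _ ht0, smul_zero, smul_zero,
        zero_add, zero_add] at hbu
      have := eq_of_sum_smul_eq_of_linearIndepOn (linearIndepOn_erase_zero ht0 (O.indep ht)) hbu v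
        (Finset.mem_erase.2 ⟨hv, hvt⟩)
      rw [← this]
      field_simp
    · rw [hb v hvt, hu.eq_zero v fun h => hvt (hst h), mul_zero]
  rw [key s hs.1 hs0 Finset.inter_subset_left w hws hxu,
    key s' hs'.1 hs0' Finset.inter_subset_right w' hws' (hxx' ▸ hxu)]

variable {O : Geometry.SimplicialComplex ℝ (Fin k → ℝ)} {τ : Finset (Fin k → ℝ)}

lemma IsOrange.linearIndepOn (hO : IsOrange i O τ) (hτ0 : (0 : Fin k → ℝ) ∈ τ) :
    LinearIndepOn ℝ id (↑(τ.erase 0) : Set (Fin k → ℝ)) :=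
  linearIndepOn_erase_zero hτ0 (O.indep hO.mem)

lemma IsOrange.isFan (hO : IsOrange i O τ) (hτ0 : (0 : Fin k → ℝ) ∈ τ) : IsFan O.faces :=
  isFan_faces O hO.finite ⟨τ, hO.mem⟩ fun s hs => hO.medial s hs hτ0

/-- The medial simplex spans the kernel of the projection. -/
lemma IsOrange.exists_sum_eq (hik : i ≤ k) (hO : IsOrange i O τ)
    (hτ : ∀ v ∈ τ, proj hik v = 0) (hτ0 : (0 : Fin k → ℝ) ∈ τ) {x : Fin k → ℝ}
    (hx : proj hik x = 0) : ∃ c : (Fin k → ℝ) → ℝ, ∑ v ∈ τ, c v • v = x := by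
  let P := LinearMap.funLeft ℝ ℝ (Fin.castLE hik)
  have hle : Submodule.span ℝ (↑(τ.erase 0) : Set (Fin k → ℝ)) ≤ LinearMap.ker P := by
    rw [Submodule.span_le]
    exact fun v hv => hτ v (Finset.mem_of_mem_erase hv)
  -- The nonzero vertices of `τ` lie in the kernel, are independent, and their number `k - i` is the
  -- dimension of the kernel.
  have h1 : Module.finrank ℝ (Submodule.span ℝ (↑(τ.erase 0) : Set (Fin k → ℝ))) = k - i := by
    rw [finrank_span_finset_eq_card (hO.linearIndepOn hτ0), Finset.card_erase_of_mem hτ0, hO.card,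
      Nat.add_sub_cancel]
  have h2 : Module.finrank ℝ (LinearMap.ker P) = k - i := by
    have h3 := P.finrank_range_add_finrank_ker
    have h4 : LinearMap.range P = ⊤ := LinearMap.range_eq_top.2
      (LinearMap.funLeft_surjective_of_injective ℝ ℝ _ (Fin.castLE_injective hik))
    rw [h4, finrank_top, Module.finrank_fin_fun, Module.finrank_fin_fun] at h3
    omega
  have h3 := Submodule.eq_of_le_of_finrank_eq hle (h1.trans h2.symm)
  have h4 : x ∈ Submodule.span ℝ (↑(τ.erase 0) : Set (Fin k → ℝ)) := by
    rw [h3]; exact hx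
  obtain ⟨c, -, hc⟩ := Submodule.mem_span_finset.1 h4
  refine ⟨c, ?_⟩
  rw [← Finset.add_sum_erase τ _ hτ0, smul_zero, zero_add]
  exact hc

/-- Conical combinations of the non-medial vertices are determined by their projections. -/
lemma IsOrange.eq_of_proj_sum_eq (hik : i ≤ k) (hO : IsOrange i O τ)
    (hτ : ∀ v ∈ τ, proj hik v = 0) (hτ0 : (0 : Fin k → ℝ) ∈ τ) {s s' : Finset (Fin k → ℝ)}
    (hs : s ∈ O.facets) (hs' : s' ∈ O.facets) {w w' : (Fin k → ℝ) → ℝ}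
    (hw : ∀ v, 0 ≤ w v) (hw' : ∀ v, 0 ≤ w' v) (hws : ∀ v, v ∉ s → w v = 0)
    (hws' : ∀ v, v ∉ s' → w' v = 0)
    (he : ∑ v ∈ s, w v • proj hik v = ∑ v ∈ s', w' v • proj hik v) :
    ∀ v, v ∉ τ → w v = w' v := by
  intro v hv
  rw [← proj_sum_smul, ← proj_sum_smul] at he
  have h0 : proj hik (∑ v ∈ s, w v • v - ∑ v ∈ s', w' v • v) = 0 := by
    rw [proj_eq_funLeft, map_sub, ← proj_eq_funLeft, ← proj_eq_funLeft, he, sub_self]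
  obtain ⟨c, hc⟩ := hO.exists_sum_eq hik hτ hτ0 h0
  -- The two combinations differ by an element of the span of `τ`. Moving its positive and negative
  -- parts to opposite sides keeps both sides conical, since `τ` lies in every facet, and does not
  -- affect weights off `τ`.
  let p : (Fin k → ℝ) → ℝ := fun v => if v ∈ τ then max (c v) 0 else 0
  let m : (Fin k → ℝ) → ℝ := fun v => if v ∈ τ then max (-c v) 0 else 0
  have hp : ∀ v, 0 ≤ p v := fun v => by simp only [p]; split_ifs <;> simp
  have hm : ∀ v, 0 ≤ m v := fun v => by simp only [m]; split_ifs <;> simp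
  have hps : ∀ t ∈ O.facets, ∀ v, v ∉ t → p v = 0 :=
    fun t ht v hv => if_neg fun h => hv (hO.medial t ht h)
  have hms : ∀ t ∈ O.facets, ∀ v, v ∉ t → m v = 0 :=
    fun t ht v hv => if_neg fun h => hv (hO.medial t ht h)
  have hsum : ∀ t ∈ O.facets, ∀ b : (Fin k → ℝ) → ℝ, (∀ v, v ∉ τ → b v = 0) →
      ∑ v ∈ t, b v • v = ∑ v ∈ τ, b v • v := fun t ht b hb =>
    (Finset.sum_subset (hO.medial t ht) fun v _ hv => by rw [hb v hv, zero_smul]).symm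
  have h1 : ∑ v ∈ s, (w v + m v) • v = ∑ v ∈ s', (w' v + p v) • v := by
    simp only [add_smul, Finset.sum_add_distrib]
    rw [hsum s hs m fun v hv => if_neg hv, hsum s' hs' p fun v hv => if_neg hv]
    have h2 : ∑ v ∈ τ, p v • v - ∑ v ∈ τ, m v • v = ∑ v ∈ τ, c v • v := by
      rw [← Finset.sum_sub_distrib]
      refine Finset.sum_congr rfl fun v hv => ?_
      simp only [p, m, if_pos hv, ← sub_smul]
      rw [max_zero_sub_max_neg_zero_eq_self]
    rw [hc] at h2
    linear_combination (exp := 1) -h2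
  have h2 := (hO.isFan hτ0).eq_of_sum_eq s hs s' hs' _ _ (fun v => add_nonneg (hw v) (hm v))
    (fun v => add_nonneg (hw' v) (hp v)) (fun v hv => by rw [hws v hv, hms s hs v hv, add_zero])
    (fun v hv => by rw [hws' v hv, hps s' hs' v hv, add_zero]) h1 v fun h => hv (h ▸ hτ0)
  simpa [p, m, hv] using h2

lemma IsOrange.exists_facet_of_mem_maximalFaces (hik : i ≤ k) (hO : IsOrange i O τ)
    {ω : Finset (Fin i → ℝ)} (hω : ω ∈ maximalFaces (projectedOrange hik O)) :
    ∃ s ∈ O.facets, ω = s.image (proj hik) := by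
  obtain ⟨⟨t, ht, rfl⟩, hmax⟩ := hω
  obtain ⟨s, hs, hts⟩ := exists_maximalFace_of_finite hO.finite ht
  exact ⟨s, hs, hmax _ ⟨s, hs.1, rfl⟩ (Finset.image_subset_image hts)⟩

/-- The projected orange is a fan. -/
lemma IsOrange.isFan_projectedOrange (hik : i ≤ k) (hO : IsOrange i O τ)
    (hτ : ∀ v ∈ τ, proj hik v = 0) (hτ0 : (0 : Fin k → ℝ) ∈ τ) :
    IsFan (projectedOrange hik O) := by
  refine ⟨hO.finite.image _, ⟨_, τ, hO.mem, rfl⟩, fun ω hω => ?_, ?_⟩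
  · obtain ⟨s, hs, rfl⟩ := hO.exists_facet_of_mem_maximalFaces hik hω
    exact Finset.mem_image.2 ⟨0, hO.medial s hs hτ0, rfl⟩
  intro ω hω ω' hω' w w' hw hw' hwω hwω' he u hu
  obtain ⟨s, hs, rfl⟩ := hO.exists_facet_of_mem_maximalFaces hik hω
  obtain ⟨s', hs', rfl⟩ := hO.exists_facet_of_mem_maximalFaces hik hω'
  -- Uniqueness applied to indicator weights: projection is injective on the non-medial vertices of
  -- a facet, so weights on the projected simplex lift to them.
  have hinj : ∀ t ∈ O.facets, ∀ x ∈ t \ τ, ∀ y ∈ t \ τ, proj hik x = proj hik y → x = y := by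
    intro t ht x hx y hy hxy
    rw [Finset.mem_sdiff] at hx hy
    have := hO.eq_of_proj_sum_eq hik hτ hτ0 ht ht (w := fun v => if v = x then 1 else 0)
      (w' := fun v => if v = y then 1 else 0) (fun v => by split_ifs <;> simp)
      (fun v => by split_ifs <;> simp) (fun v hv => if_neg fun h : v = x => hv (by rw [h]; exact hx.1))
      (fun v hv => if_neg fun h : v = y => hv (by rw [h]; exact hy.1))
      (by simp [hx.1, hy.1, hxy]) x hx.2
    by_contra hne
    simp [hne] at this
  have hlift : ∀ t ∈ O.facets, ∀ b : (Fin i → ℝ) → ℝ,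
      ∑ v ∈ t, (if v ∈ t \ τ then b (proj hik v) else 0) • proj hik v =
        ∑ u ∈ t.image (proj hik), b u • u := by
    intro t ht b
    have h1 : ∑ u ∈ t.image (proj hik), b u • u = ∑ u ∈ (t \ τ).image (proj hik), b u • u := by
      symm
      refine Finset.sum_subset (Finset.image_subset_image Finset.sdiff_subset) fun u hu hu' => ?_
      obtain ⟨v, hv, rfl⟩ := Finset.mem_image.1 hu
      have : v ∈ τ := by
        by_contra h
        exact hu' (Finset.mem_image_of_mem _ (Finset.mem_sdiff.2 ⟨hv, h⟩))
      rw [hτ v this, smul_zero]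
    rw [h1, Finset.sum_image fun x hx y hy h => hinj t ht x hx y hy h,
      ← Finset.sum_subset (Finset.sdiff_subset (s := t) (t := τ))]
    · exact Finset.sum_congr rfl fun v hv => by rw [if_pos hv]
    · exact fun v _ hv => by rw [if_neg hv, zero_smul]
  have key := hO.eq_of_proj_sum_eq hik hτ hτ0 hs hs'
    (w := fun v => if v ∈ s \ τ then w (proj hik v) else 0)
    (w' := fun v => if v ∈ s' \ τ then w' (proj hik v) else 0)
    (fun v => by split_ifs; exacts [hw _, le_rfl]) (fun v => by split_ifs; exacts [hw' _, le_rfl])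
    (fun v hv => if_neg fun h => hv (Finset.mem_sdiff.1 h).1)
    (fun v hv => if_neg fun h => hv (Finset.mem_sdiff.1 h).1)
    (by rw [hlift s hs, hlift s' hs', he])
  have hvτ : ∀ v, proj hik v = u → v ∉ τ := fun v hv h => hu (by rw [← hv, hτ v h])
  by_cases h1 : u ∈ s.image (proj hik)
  · obtain ⟨v, hv, hvu⟩ := Finset.mem_image.1 h1
    have hk := key v (hvτ v hvu)
    simp only [Finset.mem_sdiff, hv, hvτ v hvu, not_false_eq_true, and_self, if_true, and_true,
      hvu] at hk
    rw [hk]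
    split_ifs with hv'
    · rfl
    · rw [if_neg hv'] at hk
      by_cases h2 : u ∈ s'.image (proj hik)
      · obtain ⟨v', hv', hvu'⟩ := Finset.mem_image.1 h2
        have hk' := key v' (hvτ v' hvu')
        simp only [Finset.mem_sdiff, hv', hvτ v' hvu', not_false_eq_true, and_self, if_true,
          and_true, hvu', hk, ite_self] at hk'
        exact hk'
      · exact (hwω' u h2).symm
  · rw [hwω u h1]
    by_cases h2 : u ∈ s'.image (proj hik)
    · obtain ⟨v', hv', hvu'⟩ := Finset.mem_image.1 h2
      have hk' := key v' (hvτ v' hvu')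
      simp only [Finset.mem_sdiff, hv', hvτ v' hvu', not_false_eq_true, and_self, if_true,
        and_true, hvu', hwω u h1, ite_self] at hk'
      exact hk'
    · exact (hwω' u h2).symm

end Orange

/-! ### The join of a fan with the medial simplex -/

section SpecialOrange

variable {i k : ℕ} {C : Set (Finset (Fin i → ℝ))} {τ : Finset (Fin k → ℝ)}

/-- The projection inverts `embed` and kills `τ`, so only the origin could be shared. Removing it
from `τ` lets sums and products over the join split. -/
lemma disjoint_image_embed (hik : i ≤ k) (hτ : ∀ v ∈ τ, proj hik v = 0)
    (ω : Finset (Fin i → ℝ)) : Disjoint (ω.image (embed k)) (τ.erase 0) := by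
  rw [Finset.disjoint_left]
  rintro _ hx hxτ
  obtain ⟨u, -, rfl⟩ := Finset.mem_image.1 hx
  obtain ⟨h0, h⟩ := Finset.mem_erase.1 hxτ
  have := hτ _ h
  rw [proj_embed] at this
  exact h0 (by rw [this, embed_zero])

lemma sum_image_embed_union (hik : i ≤ k) (hτ : ∀ v ∈ τ, proj hik v = 0)
    {A : Type*} [AddCommMonoid A] (ω : Finset (Fin i → ℝ)) (f : (Fin k → ℝ) → A) :
    ∑ v ∈ ω.image (embed k) ∪ τ.erase 0, f v = ∑ u ∈ ω, f (embed k u) + ∑ v ∈ τ.erase 0, f v := by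
  rw [Finset.sum_union (disjoint_image_embed hik hτ ω),
    Finset.sum_image (embed_injective hik).injOn]

lemma prod_image_embed_union (hik : i ≤ k) (hτ : ∀ v ∈ τ, proj hik v = 0)
    {A : Type*} [CommMonoid A] (ω : Finset (Fin i → ℝ)) (f : (Fin k → ℝ) → A) :
    ∏ v ∈ ω.image (embed k) ∪ τ.erase 0, f v =
      (∏ u ∈ ω, f (embed k u)) * ∏ v ∈ τ.erase 0, f v := by
  rw [Finset.prod_union (disjoint_image_embed hik hτ ω),
    Finset.prod_image (embed_injective hik).injOn]

lemma sum_smul_image_embed_union (hik : i ≤ k) (hτ : ∀ v ∈ τ, proj hik v = 0)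
    (ω : Finset (Fin i → ℝ)) (w : (Fin k → ℝ) → ℝ) :
    ∑ v ∈ ω.image (embed k) ∪ τ.erase 0, w v • v =
      embed k (∑ u ∈ ω, w (embed k u) • u) + ∑ v ∈ τ.erase 0, w v • v := by
  rw [sum_image_embed_union hik hτ, embed_sum_smul ω fun u => w (embed k u)]

lemma proj_sum_smul_erase (hik : i ≤ k) (hτ : ∀ v ∈ τ, proj hik v = 0)
    (w : (Fin k → ℝ) → ℝ) : proj hik (∑ v ∈ τ.erase 0, w v • v) = 0 := by
  rw [proj_sum_smul]
  exact Finset.sum_eq_zero fun v hv => by rw [hτ v (Finset.mem_of_mem_erase hv), smul_zero]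

/-- Joining with the medial vertices preserves and reflects inclusion of base simplices, because the
embedded base is disjoint from those vertices. -/
lemma mem_maximalFaces_specialOrange (hik : i ≤ k) (hτ : ∀ v ∈ τ, proj hik v = 0)
    (hC : IsFan C) {s : Finset (Fin k → ℝ)} :
    s ∈ maximalFaces (specialOrange C τ) ↔
      ∃ ω ∈ maximalFaces C, s = ω.image (embed k) ∪ τ.erase 0 := by
  have hmem : ∀ ω ∈ maximalFaces C, ω.image (embed k) ∪ τ.erase 0 ∈ specialOrange C τ :=
    fun ω hω => ⟨⟨embed k 0, Finset.mem_union_left _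
      (Finset.mem_image_of_mem _ (hC.zero_mem ω hω))⟩, ω, hω.1, subset_rfl⟩
  constructor
  · rintro ⟨⟨-, ω, hω, hs⟩, hmax⟩
    obtain ⟨ω', hω', hωω'⟩ := exists_maximalFace_of_finite hC.finite hω
    exact ⟨ω', hω', hmax _ (hmem ω' hω') (hs.trans
      (Finset.union_subset_union_left (Finset.image_subset_image hωω')))⟩
  · rintro ⟨ω, hω, rfl⟩
    refine ⟨hmem ω hω, ?_⟩
    rintro t ⟨-, ω', hω', ht⟩ hωt
    have hle : ω ⊆ ω' := by
      intro u hu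
      have h1 : embed k u ∈ ω.image (embed k) := Finset.mem_image_of_mem _ hu
      have h2 := ht (hωt (Finset.mem_union_left _ h1))
      rcases Finset.mem_union.1 h2 with h3 | h3
      · obtain ⟨u', hu', he⟩ := Finset.mem_image.1 h3
        rwa [← embed_injective hik he]
      · exact absurd h3 (Finset.disjoint_left.1 (disjoint_image_embed hik hτ ω) h1)
    rw [← hω.2 ω' hω' hle] at ht
    exact subset_antisymm hωt ht

/-- The special orange over a fan is a fan. -/
lemma IsFan.specialOrange (hik : i ≤ k) (hτ : ∀ v ∈ τ, proj hik v = 0)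
    (hlin : LinearIndepOn ℝ id (↑(τ.erase 0) : Set (Fin k → ℝ))) (hC : IsFan C) :
    IsFan (specialOrange C τ) := by
  refine ⟨?_, ?_, fun s hs => ?_, ?_⟩
  · refine (hC.finite.biUnion fun ω _ =>
      Finset.finite_toSet (ω.image (embed k) ∪ τ.erase 0).powerset).subset ?_
    rintro s ⟨-, ω, hω, hs⟩
    exact Set.mem_biUnion hω (Finset.mem_coe.2 (Finset.mem_powerset.2 hs))
  · obtain ⟨ω, hω⟩ := hC.exists_maximalFace
    exact ⟨_, ((mem_maximalFaces_specialOrange hik hτ hC).2 ⟨ω, hω, rfl⟩).1⟩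
  · obtain ⟨ω, hω, rfl⟩ := (mem_maximalFaces_specialOrange hik hτ hC).1 hs
    exact Finset.mem_union_left _ (Finset.mem_image.2 ⟨0, hC.zero_mem ω hω, embed_zero⟩)
  · intro s hs s' hs' w w' hw hw' hws hws' he v hv
    obtain ⟨ω, hω, rfl⟩ := (mem_maximalFaces_specialOrange hik hτ hC).1 hs
    obtain ⟨ω', hω', rfl⟩ := (mem_maximalFaces_specialOrange hik hτ hC).1 hs'
    rw [sum_smul_image_embed_union hik hτ, sum_smul_image_embed_union hik hτ] at he
    have hnot : ∀ {ω : Finset (Fin i → ℝ)} {u}, u ∉ ω →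
        embed k u ∉ ω.image (embed k) ∪ τ.erase 0 := by
      intro ω u hu h
      rcases Finset.mem_union.1 h with h | h
      · obtain ⟨u', hu', h⟩ := Finset.mem_image.1 h
        exact hu (embed_injective hik h ▸ hu')
      · exact Finset.disjoint_left.1 (disjoint_image_embed hik hτ {u})
          (Finset.mem_image_of_mem _ (Finset.mem_singleton_self u)) h
    -- Projecting isolates the base weights, handled by the fan `C`; cancelling the base part leaves
    -- a relation among the independent medial vertices.
    have h1 := congrArg (proj hik) he
    rw [proj_add, proj_add, proj_embed, proj_embed, proj_sum_smul_erase hik hτ,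
      proj_sum_smul_erase hik hτ, add_zero, add_zero] at h1
    have h2 := hC.eq_of_sum_eq ω hω ω' hω' (fun u => w (embed k u)) (fun u => w' (embed k u))
      (fun u => hw _) (fun u => hw' _) (fun u hu => hws _ (hnot hu)) (fun u hu => hws' _ (hnot hu))
      h1
    rw [h1] at he
    have h3 := eq_of_sum_smul_eq_of_linearIndepOn hlin (add_left_cancel he)
    by_cases hvτ : v ∈ τ.erase 0
    · exact h3 v hvτ
    by_cases hve : ∃ u : Fin i → ℝ, embed k u = v
    · obtain ⟨u, rfl⟩ := hve
      exact h2 u fun h => hv (by rw [h, embed_zero])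
    · have hn : ∀ ω : Finset (Fin i → ℝ), v ∉ ω.image (embed k) ∪ τ.erase 0 := by
        intro ω h
        rcases Finset.mem_union.1 h with h | h
        · obtain ⟨u, -, h⟩ := Finset.mem_image.1 h
          exact hve ⟨u, h⟩
        · exact hvτ h
      rw [hws v (hn ω), hws' v (hn ω')]

end SpecialOrange

/-! ### Layers of coefficients and the determining property -/

section Layers

variable {i k : ℕ} {C : Set (Finset (Fin i → ℝ))} {τ : Finset (Fin k → ℝ)} {r d : ℕ}

/-- The function on `ℝᵏ` given by `β` on the vertices of `τ` other than the origin and by `α` on the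
embedded `ℝⁱ`. -/
noncomputable def joinFun {R : Type*} [Zero R] (τ : Finset (Fin k → ℝ)) (β : (Fin k → ℝ) → R)
    (α : (Fin i → ℝ) → R) : (Fin k → ℝ) → R :=
  fun x => if x ∈ τ.erase 0 then β x else Function.extend (embed k) α 0 x

section joinFun

variable {R : Type*} [Zero R] {β : (Fin k → ℝ) → R} {α : (Fin i → ℝ) → R}

lemma joinFun_of_mem {x : Fin k → ℝ} (hx : x ∈ τ.erase 0) : joinFun τ β α x = β x := if_pos hx

lemma joinFun_embed (hik : i ≤ k) (hτ : ∀ v ∈ τ, proj hik v = 0) (u : Fin i → ℝ) :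
    joinFun τ β α (embed k u) = α u := by
  have h : embed k u ∉ τ.erase 0 := Finset.disjoint_left.1 (disjoint_image_embed hik hτ {u})
    (Finset.mem_image_of_mem _ (Finset.mem_singleton_self u))
  rw [joinFun, if_neg h, (embed_injective hik).extend_apply]

lemma joinFun_eq_zero (hik : i ≤ k) {ω : Finset (Fin i → ℝ)} (hα : ∀ u, u ∉ ω → α u = 0)
    {x : Fin k → ℝ} (hx : x ∉ ω.image (embed k) ∪ τ.erase 0) : joinFun τ β α x = 0 := by
  rw [Finset.mem_union, not_or] at hx
  rw [joinFun, if_neg hx.2]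
  by_cases h : ∃ u : Fin i → ℝ, embed k u = x
  · obtain ⟨u, rfl⟩ := h
    rw [(embed_injective hik).extend_apply]
    exact hα u fun h => hx.1 (Finset.mem_image_of_mem _ h)
  · rw [Function.extend_apply' _ _ _ h]
    rfl

end joinFun

lemma joinFun_mem_piAntidiag (hik : i ≤ k) (hτ : ∀ v ∈ τ, proj hik v = 0) (hτ0 : 0 ∈ τ)
    {ω : Finset (Fin i → ℝ)} {γ : (Fin k → ℝ) → ℕ} (hγ : γ ∈ τ.piAntidiag d)
    {α : (Fin i → ℝ) → ℕ} (hα : α ∈ ω.piAntidiag (γ 0)) :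
    joinFun τ γ α ∈ (ω.image (embed k) ∪ τ.erase 0).piAntidiag d := by
  rw [Finset.mem_piAntidiag] at hγ hα ⊢
  refine ⟨?_, fun x hx => not_imp_comm.1
    (joinFun_eq_zero hik fun u hu => not_imp_comm.1 (hα.2 u) hu) hx⟩
  rw [sum_image_embed_union hik hτ, Finset.sum_congr rfl fun u _ => joinFun_embed hik hτ u, hα.1,
    Finset.sum_congr rfl fun x hx => joinFun_of_mem hx, Finset.add_sum_erase τ γ hτ0, hγ.1]

/-- The index on `τ` of an index on the join of `ω` and `τ`. -/
noncomputable def medialIndex (τ : Finset (Fin k → ℝ)) (ω : Finset (Fin i → ℝ))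
    (δ : (Fin k → ℝ) → ℕ) : (Fin k → ℝ) → ℕ :=
  fun x => if x = 0 then ∑ u ∈ ω, δ (embed k u) else if x ∈ τ.erase 0 then δ x else 0

section medialIndex

variable {ω : Finset (Fin i → ℝ)} {δ : (Fin k → ℝ) → ℕ}

lemma medialIndex_zero : medialIndex τ ω δ 0 = ∑ u ∈ ω, δ (embed k u) := if_pos rfl

lemma medialIndex_of_mem {x : Fin k → ℝ} (hx : x ∈ τ.erase 0) : medialIndex τ ω δ x = δ x := by
  rw [medialIndex, if_neg (Finset.mem_erase.1 hx).1, if_pos hx]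

lemma medialIndex_mem (hik : i ≤ k) (hτ : ∀ v ∈ τ, proj hik v = 0) (hτ0 : 0 ∈ τ)
    (hδ : δ ∈ (ω.image (embed k) ∪ τ.erase 0).piAntidiag d) :
    medialIndex τ ω δ ∈ τ.piAntidiag d := by
  rw [Finset.mem_piAntidiag] at hδ ⊢
  constructor
  · rw [← hδ.1, sum_image_embed_union hik hτ, ← Finset.add_sum_erase τ _ hτ0, medialIndex_zero,
      Finset.sum_congr rfl fun x hx => medialIndex_of_mem hx]
  · intro x hx
    by_contra hxτ
    rw [medialIndex, if_neg fun h : x = 0 => hxτ (h ▸ hτ0),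
      if_neg fun h => hxτ (Finset.mem_of_mem_erase h)] at hx
    exact hx rfl

lemma comp_embed_mem (hik : i ≤ k) (hτ : ∀ v ∈ τ, proj hik v = 0)
    (hδ : δ ∈ (ω.image (embed k) ∪ τ.erase 0).piAntidiag d) :
    (fun u => δ (embed k u)) ∈ ω.piAntidiag (medialIndex τ ω δ 0) := by
  rw [Finset.mem_piAntidiag] at hδ ⊢
  refine ⟨medialIndex_zero.symm, fun u hu => ?_⟩
  rcases Finset.mem_union.1 (hδ.2 _ hu) with h | h
  · obtain ⟨u', hu', he⟩ := Finset.mem_image.1 h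
    rwa [← embed_injective hik he]
  · exact absurd h (Finset.disjoint_left.1 (disjoint_image_embed hik hτ {u})
      (Finset.mem_image_of_mem _ (Finset.mem_singleton_self u)))

lemma joinFun_medialIndex (hik : i ≤ k) (hτ : ∀ v ∈ τ, proj hik v = 0)
    (hδ : δ ∈ (ω.image (embed k) ∪ τ.erase 0).piAntidiag d) :
    joinFun τ (medialIndex τ ω δ) (fun u : Fin i → ℝ => δ (embed k u)) = δ := by
  have hc := Finset.mem_piAntidiag.1 (comp_embed_mem hik hτ hδ)
  rw [Finset.mem_piAntidiag] at hδ
  ext x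
  by_cases hx : x ∈ ω.image (embed k) ∪ τ.erase 0
  · rcases Finset.mem_union.1 hx with h | h
    · obtain ⟨u, -, rfl⟩ := Finset.mem_image.1 h
      rw [joinFun_embed hik hτ]
    · rw [joinFun_of_mem h, medialIndex_of_mem h]
  · rw [joinFun_eq_zero hik (fun u hu => not_imp_comm.1 (hc.2 u) hu) hx,
      not_imp_comm.1 (hδ.2 x) hx]

end medialIndex

/-- The factor `(γ 0)!` in the denominator of the medial coefficient cancels against the numerator
of the base coefficient. -/
lemma multinomial_joinFun (hik : i ≤ k) (hτ : ∀ v ∈ τ, proj hik v = 0) (hτ0 : 0 ∈ τ)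
    {ω : Finset (Fin i → ℝ)} {γ : (Fin k → ℝ) → ℕ} (hγ : γ ∈ τ.piAntidiag d)
    {α : (Fin i → ℝ) → ℕ} (hα : α ∈ ω.piAntidiag (γ 0)) :
    Nat.multinomial (ω.image (embed k) ∪ τ.erase 0) (joinFun τ γ α) =
      Nat.multinomial τ γ * Nat.multinomial ω α := by
  have h1 := Nat.multinomial_spec (ω.image (embed k) ∪ τ.erase 0) (joinFun τ γ α)
  rw [(Finset.mem_piAntidiag.1 (joinFun_mem_piAntidiag hik hτ hτ0 hγ hα)).1,
    prod_image_embed_union hik hτ] at h1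
  have hT : ∏ v ∈ τ.erase 0, (joinFun τ γ α v).factorial = ∏ v ∈ τ.erase 0, (γ v).factorial :=
    Finset.prod_congr rfl fun x hx => by rw [joinFun_of_mem hx]
  simp only [joinFun_embed hik hτ, hT] at h1
  have h2 := Nat.multinomial_spec τ γ
  rw [(Finset.mem_piAntidiag.1 hγ).1, ← Finset.mul_prod_erase τ _ hτ0] at h2
  have h3 := Nat.multinomial_spec ω α
  rw [(Finset.mem_piAntidiag.1 hα).1] at h3
  have hpos : 0 < (∏ u ∈ ω, (α u).factorial) * ∏ v ∈ τ.erase 0, (γ v).factorial := by positivity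
  refine Nat.eq_of_mul_eq_mul_left hpos (h1.trans ?_)
  rw [← h2, ← h3]
  ring

/-- The Bernstein sum of a join, arranged by the indices on the medial simplex. -/
lemma bernsteinSum_join (hik : i ≤ k) (hτ : ∀ v ∈ τ, proj hik v = 0) (hτ0 : 0 ∈ τ)
    (ω : Finset (Fin i → ℝ)) (c : ((Fin k → ℝ) → ℕ) → ℝ) (θ : (Fin k → ℝ) → ℝ)
    (b : (Fin i → ℝ) → ℝ) :
    bernsteinSum (ω.image (embed k) ∪ τ.erase 0) d c (joinFun τ θ (θ 0 • b)) =
      bernsteinSum τ d (fun γ => bernsteinSum ω (γ 0) (fun α => c (joinFun τ γ α)) b) θ := by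
  symm
  simp only [bernsteinSum, Finset.sum_mul]
  rw [Finset.sum_sigma']
  refine Finset.sum_bij' (fun p _ => joinFun τ p.1 p.2)
    (fun δ _ => ⟨medialIndex τ ω δ, fun u => δ (embed k u)⟩) ?_ ?_ ?_ ?_ ?_
  · rintro ⟨γ, α⟩ h
    obtain ⟨hγ, hα⟩ := Finset.mem_sigma.1 h
    exact joinFun_mem_piAntidiag hik hτ hτ0 hγ hα
  · intro δ hδ
    exact Finset.mem_sigma.2 ⟨medialIndex_mem hik hτ hτ0 hδ, comp_embed_mem hik hτ hδ⟩
  · rintro ⟨γ, α⟩ h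
    obtain ⟨hγ, hα⟩ := Finset.mem_sigma.1 h
    simp only [Finset.mem_piAntidiag] at hγ hα
    have h1 : (fun u => joinFun τ γ α (embed k u)) = α := funext fun u => joinFun_embed hik hτ u
    have h2 : medialIndex τ ω (joinFun τ γ α) = γ := by
      ext x
      by_cases hx0 : x = 0
      · rw [hx0, medialIndex_zero, ← hα.1]
        exact Finset.sum_congr rfl fun u _ => joinFun_embed hik hτ u
      · by_cases hx : x ∈ τ
        · have hx' := Finset.mem_erase.2 ⟨hx0, hx⟩
          rw [medialIndex_of_mem hx', joinFun_of_mem hx']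
        · rw [medialIndex, if_neg hx0, if_neg fun h => hx (Finset.mem_of_mem_erase h),
            not_imp_comm.1 (hγ.2 x) hx]
    simp only [h1, h2]
  · intro δ hδ
    exact joinFun_medialIndex hik hτ hδ
  · rintro ⟨γ, α⟩ h
    obtain ⟨hγ, hα⟩ := Finset.mem_sigma.1 h
    dsimp only at hγ hα ⊢
    rw [multinomial_joinFun hik hτ hτ0 hγ hα, prod_image_embed_union hik hτ,
      ← Finset.mul_prod_erase τ _ hτ0]
    have hT : ∏ v ∈ τ.erase 0, joinFun τ θ (θ 0 • b) v ^ joinFun τ γ α v =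
        ∏ v ∈ τ.erase 0, θ v ^ γ v :=
      Finset.prod_congr rfl fun x hx => by rw [joinFun_of_mem hx, joinFun_of_mem hx]
    simp only [joinFun_embed hik hτ, hT, Pi.smul_apply, smul_eq_mul, mul_pow]
    -- The factors `θ 0` of the base weights collect to `θ 0 ^ γ 0`, which completes the medial
    -- monomial.
    rw [Finset.prod_mul_distrib, Finset.prod_pow_eq_pow_sum, (Finset.mem_piAntidiag.1 hα).1]
    push_cast
    ring

lemma isWeight_joinFun (hik : i ≤ k) (hτ : ∀ v ∈ τ, proj hik v = 0) (hτ0 : 0 ∈ τ)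
    {ω : Finset (Fin i → ℝ)} {θ : (Fin k → ℝ) → ℝ} (hθ : IsWeight τ θ) {b : (Fin i → ℝ) → ℝ}
    (hb : IsWeight ω b) :
    IsWeight (ω.image (embed k) ∪ τ.erase 0) (joinFun τ θ (θ 0 • b)) := by
  have hz : ∀ x, x ∉ ω.image (embed k) ∪ τ.erase 0 → joinFun τ θ (θ 0 • b) x = 0 := fun x hx =>
    joinFun_eq_zero hik (fun u hu => by rw [Pi.smul_apply, hb.eq_zero u hu, smul_zero]) hx
  refine ⟨fun x => ?_, hz, ?_⟩
  · by_cases hx : x ∈ ω.image (embed k) ∪ τ.erase 0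
    · rcases Finset.mem_union.1 hx with h | h
      · obtain ⟨u, -, rfl⟩ := Finset.mem_image.1 h
        rw [joinFun_embed hik hτ]
        exact mul_nonneg (hθ.nonneg 0) (hb.nonneg u)
      · rw [joinFun_of_mem h]
        exact hθ.nonneg x
    · exact (hz x hx).ge
  · rw [sum_image_embed_union hik hτ, Finset.sum_congr rfl fun u _ => joinFun_embed hik hτ u,
      Finset.sum_congr rfl fun x hx => joinFun_of_mem hx, ← hθ.sum_eq,
      ← Finset.add_sum_erase τ _ hτ0]
    simp only [Pi.smul_apply, smul_eq_mul]
    rw [← Finset.mul_sum, hb.sum_eq, mul_one]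

lemma sum_joinFun_smul (hik : i ≤ k) (hτ : ∀ v ∈ τ, proj hik v = 0) (ω : Finset (Fin i → ℝ))
    (θ : (Fin k → ℝ) → ℝ) (b : (Fin i → ℝ) → ℝ) (a : ℝ) :
    ∑ x ∈ ω.image (embed k) ∪ τ.erase 0, joinFun τ θ (a • b) x • x =
      embed k (a • ∑ u ∈ ω, b u • u) + ∑ v ∈ τ.erase 0, θ v • v := by
  rw [sum_smul_image_embed_union hik hτ, Finset.smul_sum]
  congr 1
  · congr 1
    refine Finset.sum_congr rfl fun u _ => ?_
    rw [joinFun_embed hik hτ, Pi.smul_apply, smul_assoc]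
  · exact Finset.sum_congr rfl fun x hx => by rw [joinFun_of_mem hx]

/-- The index `γ 0` belongs to the origin and contributes nothing to the point, so a joined domain
point is a base point translated by a medial point. -/
lemma domainPoint_joinFun (hik : i ≤ k) (hτ : ∀ v ∈ τ, proj hik v = 0) (hτ0 : 0 ∈ τ)
    (ω : Finset (Fin i → ℝ)) (γ : (Fin k → ℝ) → ℕ) (α : (Fin i → ℝ) → ℕ) :
    domainPoint (ω.image (embed k) ∪ τ.erase 0) d (joinFun τ γ α) =
      embed k (domainPoint ω d α) + domainPoint τ d γ := by
  simp only [domainPoint]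
  rw [sum_image_embed_union hik hτ, embed_smul, embed_sum_smul ω fun u => (α u : ℝ),
    ← Finset.add_sum_erase τ _ hτ0, smul_zero, zero_add, smul_add]
  congr 2
  · exact Finset.sum_congr rfl fun u _ => by rw [joinFun_embed hik hτ]
  · exact Finset.sum_congr rfl fun x hx => by rw [joinFun_of_mem hx]

lemma embed_add_sum_mem_domain (hik : i ≤ k) (hτ : ∀ v ∈ τ, proj hik v = 0) (hτ0 : 0 ∈ τ)
    (hC : IsFan C) {θ : (Fin k → ℝ) → ℝ} (hθ : IsWeight τ θ) {u : Fin i → ℝ} (hu : u ∈ domain C) :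
    embed k (θ 0 • u) + ∑ v ∈ τ.erase 0, θ v • v ∈ domain (specialOrange C τ) := by
  obtain ⟨ω, hω, b, hb, rfl⟩ := (mem_domain_iff hC.finite).1 hu
  rw [← sum_joinFun_smul hik hτ]
  exact sum_mem_domain ((mem_maximalFaces_specialOrange hik hτ hC).2 ⟨ω, hω, rfl⟩).1
    (isWeight_joinFun hik hτ hτ0 hθ hb)

/-- Each layer of Bernstein–Bézier coefficients of a spline on the special orange is the
coefficient vector of a spline on the base. -/
lemma exists_isSpline_layer (hik : i ≤ k) (hτ : ∀ v ∈ τ, proj hik v = 0) (hτ0 : 0 ∈ τ)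
    (hC : IsFan C) {F c : (Fin k → ℝ) → ℝ} (hF : IsSpline (specialOrange C τ) r d F)
    (hc : HasBForm (specialOrange C τ) d F c) {γ : (Fin k → ℝ) → ℕ} (hγ : γ ∈ τ.piAntidiag d) :
    ∃ G, IsSpline C r (γ 0) G ∧ ∀ ω ∈ maximalFaces C, ∀ b, IsWeight ω b →
      G (∑ u ∈ ω, b u • u) = bernsteinSum ω (γ 0)
        (fun α => c (embed k (domainPoint ω d α) + domainPoint τ d γ)) b := by
  -- The same finite combination of slices isolates the layer `γ` for all `u` at once, so smoothness
  -- passes from `F` to `G` through affine substitutions.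
  obtain ⟨μ, hμ⟩ := exists_dual_weights ⟨0, hτ0⟩ d hγ
  let G : (Fin i → ℝ) → ℝ := fun u =>
    ∑ θ ∈ μ.support, μ θ * F (embed k (θ.1 0 • u) + ∑ v ∈ τ.erase 0, θ.1 v • v)
  have hG : ∀ ω ∈ maximalFaces C, ∀ b, IsWeight ω b →
      G (∑ u ∈ ω, b u • u) = bernsteinSum ω (γ 0)
        (fun α => c (embed k (domainPoint ω d α) + domainPoint τ d γ)) b := by
    intro ω hω b hb
    rw [← hμ fun γ => bernsteinSum ω (γ 0)
        (fun α => c (embed k (domainPoint ω d α) + domainPoint τ d γ)) b]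
    refine Finset.sum_congr rfl fun θ _ => ?_
    rw [← sum_joinFun_smul hik hτ, hc _ ((mem_maximalFaces_specialOrange hik hτ hC).2 ⟨ω, hω, rfl⟩) _
      (isWeight_joinFun hik hτ hτ0 θ.2 hb), bernsteinSum_join hik hτ hτ0]
    simp only [domainPoint_joinFun hik hτ hτ0]
  refine ⟨G, ⟨?_, fun ω hω => ?_⟩, hG⟩
  · refine ContDiffOn.sum fun θ _ => contDiffOn_const.mul ?_
    refine hF.1.comp (((contDiff_embed.comp (contDiff_const_smul _)).add
      contDiff_const).contDiffOn) fun u hu => ?_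
    exact embed_add_sum_mem_domain hik hτ hτ0 hC θ.2 hu
  · obtain ⟨p, hp, hpe⟩ := exists_polynomial_eq_bernsteinSum (hC.zero_mem ω hω)
      (hC.linearIndepOn hω) (γ 0)
      fun α => c (embed k (domainPoint ω d α) + domainPoint τ d γ)
    refine ⟨p, hp, fun x hx => ?_⟩
    obtain ⟨b, hb, rfl⟩ := mem_convexHull_iff_exists_isWeight.1 hx
    rw [hG ω hω b hb, hpe b hb.sum_eq]

lemma le_of_mem_piAntidiag {X : Type*} [DecidableEq X] {s : Finset X} {γ : X → ℕ}
    (hγ : γ ∈ s.piAntidiag d) {x : X} (hx : x ∈ s) : γ x ≤ d := by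
  rw [← (Finset.mem_piAntidiag.1 hγ).1]
  exact Finset.single_le_sum (fun _ _ => Nat.zero_le _) hx

lemma eq_zero_of_div_eq_zero {j : ℕ} (hj : j ≤ d) (h : (j : ℝ) / d = 0) : j = 0 := by
  rcases div_eq_zero_iff.1 h with h | h
  · exact_mod_cast h
  · have : d = 0 := by exact_mod_cast h
    omega

/-- The layered set of determining sets is determining. -/
lemma isDeterminingSet_layeredSet (hik : i ≤ k) (hτ : ∀ v ∈ τ, proj hik v = 0) (hτ0 : 0 ∈ τ)
    (hC : IsFan C) (hO : IsFan (specialOrange C τ)) {M : ℕ → Set (Fin i → ℝ)}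
    (hM : ∀ j ≤ d, IsDeterminingSet (scale ((j : ℝ) / d) C) r j (M j)) :
    IsDeterminingSet (specialOrange C τ) r d (layeredSet τ d M) := by
  constructor
  · rintro _ ⟨j, hj, y, hy, _, ⟨γ, hγ, rfl, rfl⟩, rfl⟩
    obtain ⟨ω, hω, α, hα, rfl⟩ := exists_of_mem_domainPoints_scale hC hj ((hM _ hj).1 hy)
    exact ⟨_, (mem_maximalFaces_specialOrange hik hτ hC).2 ⟨ω, hω, rfl⟩, _,
      joinFun_mem_piAntidiag hik hτ hτ0 hγ hα, (domainPoint_joinFun hik hτ hτ0 ω γ α).symm⟩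
  · rintro f ⟨F, hFf, hF⟩ c hc h0
    refine hc.eq_zero hO.finite ?_
    rw [isBForm_iff_hasBForm hFf] at hc
    rintro _ ⟨s, hs, δ, hδ, rfl⟩
    obtain ⟨ω, hω, rfl⟩ := (mem_maximalFaces_specialOrange hik hτ hC).1 hs
    have hγ := medialIndex_mem hik hτ hτ0 hδ
    have hα := comp_embed_mem hik hτ hδ
    rw [← joinFun_medialIndex hik hτ hδ, domainPoint_joinFun hik hτ hτ0]
    set γ := medialIndex τ ω δ
    set α : (Fin i → ℝ) → ℕ := fun u => δ (embed k u)
    obtain ⟨G, hG, hGc⟩ := exists_isSpline_layer hik hτ hτ0 hC hF hc hγ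
    have hj : γ 0 ≤ d := le_of_mem_piAntidiag hγ hτ0
    -- Scaling the layer by `γ 0 / d` places its coefficients at the points whose translates by
    -- `domainPoint τ d γ` are domain points of the orange; those at `M (γ 0)` vanish by hypothesis.
    obtain ⟨H, hH, hHG⟩ := hC.exists_isSpline_scale (eq_zero_of_div_eq_zero hj) hG
    have hHB := hC.hasBForm_scale hj (c := fun y => c (embed k y + domainPoint τ d γ)) hHG hGc
    have hH0 := (hM _ hj).2 _ hH.restrict_mem _ ((isBForm_iff_hasBForm fun _ => rfl).2 hHB)
      fun ξ hξ => h0 _ ⟨γ 0, hj, ξ, hξ, _, ⟨γ, hγ, rfl, rfl⟩, rfl⟩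
    refine bernsteinSum_injective ⟨0, hC.zero_mem ω hω⟩ (d := γ 0)
      (c := fun α => c (embed k (domainPoint ω d α) + domainPoint τ d γ)) (c' := 0)
      (fun b hb => ?_) α hα
    have hmem := sum_mem_domain hω.1 hb
    rw [← hGc ω hω b hb, ← hHG _ hmem]
    have := congrFun hH0 ⟨_, smul_mem_domain_scale _ hmem⟩
    simp only [bernsteinSum, Pi.zero_apply, zero_mul, Finset.sum_const_zero]
    exact this

end Layers

/-! ### Lower bound for the dimension -/

section Dimension

variable {i k : ℕ} {C : Set (Finset (Fin i → ℝ))} {τ : Finset (Fin k → ℝ)} {r d : ℕ}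

/-- Projection discards the medial weights, leaving a sub-convex combination that the origin
completes. -/
lemma proj_mem_convexHull (hik : i ≤ k) (hτ : ∀ v ∈ τ, proj hik v = 0) {ω : Finset (Fin i → ℝ)}
    (h0 : 0 ∈ ω) {x : Fin k → ℝ}
    (hx : x ∈ convexHull ℝ (↑(ω.image (embed k) ∪ τ.erase 0) : Set (Fin k → ℝ))) :
    proj hik x ∈ convexHull ℝ (ω : Set (Fin i → ℝ)) := by
  obtain ⟨w, hw, rfl⟩ := mem_convexHull_iff_exists_isWeight.1 hx
  rw [sum_smul_image_embed_union hik hτ, proj_add, proj_embed, proj_sum_smul_erase hik hτ, add_zero]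
  refine sum_mem_convexHull_of_sum_le_one h0 (fun u _ => hw.nonneg _) ?_
  have := hw.sum_eq
  rw [sum_image_embed_union hik hτ] at this
  have h1 : 0 ≤ ∑ v ∈ τ.erase 0, w v := Finset.sum_nonneg fun v _ => hw.nonneg v
  linarith

lemma proj_mem_domain (hik : i ≤ k) (hτ : ∀ v ∈ τ, proj hik v = 0) (hC : IsFan C)
    (hO : IsFan (specialOrange C τ)) {x : Fin k → ℝ} (hx : x ∈ domain (specialOrange C τ)) :
    proj hik x ∈ domain C := by
  obtain ⟨s, hs, w, hw, rfl⟩ := (mem_domain_iff hO.finite).1 hx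
  obtain ⟨ω, hω, rfl⟩ := (mem_maximalFaces_specialOrange hik hτ hC).1 hs
  exact Set.mem_biUnion hω.1 (proj_mem_convexHull hik hτ (hC.zero_mem ω hω)
    (mem_convexHull_iff_exists_isWeight.2 ⟨w, hw, rfl⟩))

/-- The coordinates of `ℝᵏ` along the medial simplex. -/
lemma exists_medial_coordinates (hik : i ≤ k) (hτ : ∀ v ∈ τ, proj hik v = 0)
    (hlin : LinearIndepOn ℝ id (↑(τ.erase 0) : Set (Fin k → ℝ))) :
    ∃ L : (Fin k → ℝ) → Module.Dual ℝ (Fin k → ℝ), ∀ v ∈ τ.erase 0, ∀ (y : Fin i → ℝ)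
      (t : (Fin k → ℝ) → ℝ), L v (embed k y + ∑ u ∈ τ.erase 0, t u • u) = t v := by
  obtain ⟨l, hl⟩ := exists_dual_family hlin
  -- Subtracting `embed k (proj hik x)` removes the base component before the medial coordinate is
  -- read.
  refine ⟨fun v => l v ∘ₗ
    (LinearMap.id - embedLin i k ∘ₗ LinearMap.funLeft ℝ ℝ (Fin.castLE hik)), fun v hv y t => ?_⟩
  rw [← hl v hv t, LinearMap.comp_apply, LinearMap.sub_apply, LinearMap.comp_apply,
    ← proj_eq_funLeft, ← embed_eq_embedLin, proj_add, proj_embed, proj_sum_smul_erase hik hτ,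
    add_zero, LinearMap.id_apply, add_sub_cancel_left]

/-- The medial monomial has degree at most `d - γ 0` and `G γ` has degree at most `γ 0`, so each
product stays within degree `d`; smoothness is inherited through the projection. -/
lemma isSpline_sum_medial (hik : i ≤ k) (hτ : ∀ v ∈ τ, proj hik v = 0) (hτ0 : 0 ∈ τ)
    (hC : IsFan C) (hO : IsFan (specialOrange C τ))
    (L : (Fin k → ℝ) → Module.Dual ℝ (Fin k → ℝ))
    {G : ((Fin k → ℝ) → ℕ) → (Fin i → ℝ) → ℝ}
    (hG : ∀ γ ∈ τ.piAntidiag d, IsSpline C r (γ 0) (G γ)) :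
    IsSpline (specialOrange C τ) r d fun x =>
      ∑ γ ∈ τ.piAntidiag d, (∏ v ∈ τ.erase 0, L v x ^ γ v) * G γ (proj hik x) := by
  refine ⟨ContDiffOn.sum fun γ hγ => ContDiffOn.mul ?_ ?_, fun s hs => ?_⟩
  · refine ContDiff.contDiffOn (contDiff_prod fun v _ => ContDiff.pow ?_ _)
    exact (LinearMap.toContinuousLinearMap (L v)).contDiff
  · exact (hG γ hγ).1.comp (contDiff_proj hik).contDiffOn
      fun x hx => proj_mem_domain hik hτ hC hO hx
  · obtain ⟨ω, hω, rfl⟩ := (mem_maximalFaces_specialOrange hik hτ hC).1 hs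
    have hex : ∀ γ : τ.piAntidiag d, ∃ p : MvPolynomial (Fin i) ℝ, p.totalDegree ≤ γ.1 0 ∧
        ∀ x ∈ convexHull ℝ (ω : Set (Fin i → ℝ)), G γ.1 x = eval x p :=
      fun γ => (hG γ.1 γ.2).2 ω hω
    choose p hp hpG using hex
    refine ⟨∑ γ : τ.piAntidiag d, (∏ v ∈ τ.erase 0, dualPoly (L v) ^ γ.1 v) *
      rename (Fin.castLE hik) (p γ), ?_, fun x hx => ?_⟩
    · refine totalDegree_finsetSum_le fun γ _ => (totalDegree_mul _ _).trans ?_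
      have h1 : (∏ v ∈ τ.erase 0, dualPoly (L v) ^ γ.1 v).totalDegree ≤ ∑ v ∈ τ.erase 0, γ.1 v := by
        refine (totalDegree_finsetProd _ _).trans (Finset.sum_le_sum fun v _ => ?_)
        refine (totalDegree_pow _ _).trans ?_
        simpa using Nat.mul_le_mul_left (γ.1 v) (totalDegree_dualPoly_le (L v))
      have h2 := (totalDegree_rename_le (Fin.castLE hik) (p γ)).trans (hp γ)
      have h3 := (Finset.mem_piAntidiag.1 γ.2).1
      rw [← Finset.add_sum_erase τ _ hτ0] at h3
      omega
    · beta_reduce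
      rw [map_sum, ← Finset.sum_coe_sort (τ.piAntidiag d)
        fun γ => (∏ v ∈ τ.erase 0, L v x ^ γ v) * G γ (proj hik x)]
      refine Finset.sum_congr rfl fun γ _ => ?_
      rw [map_mul, map_prod, eval_rename,
        hpG γ _ (proj_mem_convexHull hik hτ (hC.zero_mem ω hω) hx)]
      simp only [map_pow, eval_dualPoly]
      rfl

/-- If `∑ t ^ γ G γ` vanishes on the special orange, then all `G γ` vanish on the base. -/
lemma eq_zero_of_sum_medial_eq_zero (hik : i ≤ k) (hτ : ∀ v ∈ τ, proj hik v = 0) (hτ0 : 0 ∈ τ)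
    (hC : IsFan C) {L : (Fin k → ℝ) → Module.Dual ℝ (Fin k → ℝ)}
    (hL : ∀ v ∈ τ.erase 0, ∀ (y : Fin i → ℝ) (t : (Fin k → ℝ) → ℝ),
      L v (embed k y + ∑ u ∈ τ.erase 0, t u • u) = t v)
    {G : ((Fin k → ℝ) → ℕ) → (Fin i → ℝ) → ℝ}
    (hG : ∀ γ ∈ τ.piAntidiag d, ContinuousOn (G γ) (domain C))
    (h : ∀ x ∈ domain (specialOrange C τ),
      ∑ γ ∈ τ.piAntidiag d, (∏ v ∈ τ.erase 0, L v x ^ γ v) * G γ (proj hik x) = 0) :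
    ∀ γ ∈ τ.piAntidiag d, ∀ u ∈ domain C, G γ u = 0 := by
  intro γ hγ u hu
  -- Over a point of the outer boundary there may be no room in the medial directions; shrinking `u`
  -- by `a < 1` leaves room for small `t`.
  have h1 : ∀ a ∈ Set.Ico (0 : ℝ) 1, G γ (a • u) = 0 := by
    rintro a ⟨ha0, ha1⟩
    set N : ℝ := ((τ.erase 0).card : ℝ) with hN
    have hNpos : 0 ≤ N := by positivity
    -- With `N` medial coordinates below this bound their sum stays below `1 - a`; the `+ 1` also
    -- covers `N = 0`.
    have hε : 0 < (1 - a) / (N + 1) := div_pos (by linarith) (by positivity)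
    refine eq_zero_of_sum_monomial_eq_zero (s := τ.erase 0) (τ.piAntidiag d)
      (c := fun γ => G γ (a • u)) (I := Set.Ioo 0 ((1 - a) / (N + 1))) ?_ (Set.Ioo_infinite hε) ?_
      γ hγ
    · intro α hα β hβ he
      rw [Finset.mem_piAntidiag] at hα hβ
      ext v
      by_cases hv : v ∈ τ.erase 0
      · exact he v hv
      · by_cases hv0 : v = 0
        · have h2 := hα.1.trans hβ.1.symm
          rw [← Finset.add_sum_erase τ _ hτ0, ← Finset.add_sum_erase τ _ hτ0,
            Finset.sum_congr rfl he] at h2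
          rw [hv0]
          exact add_right_cancel h2
        · have hvτ : v ∉ τ := fun h => hv (Finset.mem_erase.2 ⟨hv0, h⟩)
          rw [not_imp_comm.1 (hα.2 v) hvτ, not_imp_comm.1 (hβ.2 v) hvτ]
    · intro t ht
      have hsum : ∑ v ∈ τ.erase 0, t v < 1 - a := by
        have h2 : ∑ v ∈ τ.erase 0, t v ≤ N * ((1 - a) / (N + 1)) := by
          rw [hN, ← nsmul_eq_mul]
          exact Finset.sum_le_card_nsmul _ _ _ fun v _ => (ht v).2.le
        have h3 : N * ((1 - a) / (N + 1)) + (1 - a) / (N + 1) = 1 - a := by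
          field_simp
        linarith
      set θ0 : ℝ := 1 - ∑ v ∈ τ.erase 0, t v with hθ0
      have hθpos : 0 < θ0 := by linarith
      let θ : (Fin k → ℝ) → ℝ := fun v => if v = 0 then θ0 else if v ∈ τ then t v else 0
      have hθT : ∀ v ∈ τ.erase 0, θ v = t v := by
        intro v hv
        rw [Finset.mem_erase] at hv
        simp only [θ, if_neg hv.1, if_pos hv.2]
      have hθz : θ 0 = θ0 := if_pos rfl
      have hθ : IsWeight τ θ := by
        refine ⟨fun v => ?_, fun v hv => ?_, ?_⟩
        · simp only [θ]
          split_ifs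
          exacts [hθpos.le, (ht v).1.le, le_rfl]
        · simp only [θ]
          rw [if_neg fun h : v = 0 => hv (by rw [h]; exact hτ0), if_neg hv]
        · rw [← Finset.add_sum_erase τ _ hτ0, hθz, Finset.sum_congr rfl hθT, hθ0]
          ring
      -- The weight left at the origin is `θ0 > a`, so `(a / θ0) • u` is still in the domain of `C`,
      -- and its multiple by `θ0` is `a • u`.
      have hmem := embed_add_sum_mem_domain hik hτ hτ0 hC hθ
        (hC.smul_mem_domain hu (a := a / θ0) (by positivity) (by rw [div_le_one hθpos]; linarith))
      rw [hθz, smul_smul, mul_div_cancel₀ _ hθpos.ne',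
        Finset.sum_congr rfl fun v hv => by rw [hθT v hv]] at hmem
      rw [← h _ hmem]
      refine Finset.sum_congr rfl fun β _ => ?_
      rw [proj_add, proj_embed, proj_sum_smul_erase hik hτ, add_zero, mul_comm]
      congr 1
      exact Finset.prod_congr rfl fun v hv => by rw [hL v hv]
  -- Continuity along the segment lets `a` tend to `1`.
  have hcont : ContinuousOn (fun a : ℝ => G γ (a • u)) (Set.Icc 0 1) :=
    (hG γ hγ).comp (by fun_prop) fun a ha => hC.smul_mem_domain hu ha.1 ha.2
  have h2 : Set.EqOn (fun a : ℝ => G γ (a • u)) (fun _ => 0) (Set.Icc 0 1) :=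
    Set.EqOn.of_subset_closure (s := Set.Ico 0 1) h1 hcont continuousOn_const
      Set.Ico_subset_Icc_self (by rw [closure_Ico zero_ne_one])
  simpa using h2 (Set.right_mem_Icc.2 zero_le_one)

/-- The dimension of the spline space of the special orange is at least the sum of the dimensions of
the layers. -/
lemma sum_finrank_le_finrank_specialOrange (hik : i ≤ k) (hτ : ∀ v ∈ τ, proj hik v = 0)
    (hτ0 : 0 ∈ τ) (hlin : LinearIndepOn ℝ id (↑(τ.erase 0) : Set (Fin k → ℝ)))
    (hC : IsFan C) (hO : IsFan (specialOrange C τ)) :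
    ∑ γ ∈ τ.piAntidiag d, Module.finrank ℝ (splineSpace C r (γ 0)) ≤
      Module.finrank ℝ (splineSpace (specialOrange C τ) r d) := by
  obtain ⟨L, hL⟩ := exists_medial_coordinates hik hτ hlin
  have hext : ∀ f : (∀ γ : τ.piAntidiag d, splineSpace C r (γ.1 0)),
      ∃ G : ((Fin k → ℝ) → ℕ) → (Fin i → ℝ) → ℝ,
        (∀ γ ∈ τ.piAntidiag d, IsSpline C r (γ 0) (G γ)) ∧
        ∀ (γ : τ.piAntidiag d) (x : domain C), G γ.1 x = (f γ).1 x := by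
    intro f
    have : ∀ γ : (Fin k → ℝ) → ℕ, ∃ G : (Fin i → ℝ) → ℝ, ∀ hγ : γ ∈ τ.piAntidiag d,
        IsSpline C r (γ 0) G ∧ ∀ x : domain C, G x = (f ⟨γ, hγ⟩).1 x := by
      intro γ
      by_cases hγ : γ ∈ τ.piAntidiag d
      · obtain ⟨G, hGf, hG⟩ := (f ⟨γ, hγ⟩).2
        exact ⟨G, fun _ => ⟨hG, hGf⟩⟩
      · exact ⟨0, fun h => absurd h hγ⟩
    choose G hG using this
    exact ⟨G, fun γ hγ => (hG γ hγ).1, fun γ => (hG γ.1 γ.2).2⟩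
  have hval : ∀ (f : ∀ γ : τ.piAntidiag d, splineSpace C r (γ.1 0))
      (G : ((Fin k → ℝ) → ℕ) → (Fin i → ℝ) → ℝ),
      (∀ (γ : τ.piAntidiag d) (x : domain C), G γ.1 x = (f γ).1 x) →
      ∀ x : domain (specialOrange C τ),
        ∑ γ ∈ τ.piAntidiag d, (∏ v ∈ τ.erase 0, L v x.1 ^ γ v) * G γ (proj hik x.1) =
          ∑ γ : τ.piAntidiag d, (∏ v ∈ τ.erase 0, L v x.1 ^ γ.1 v) *
            (f γ).1 ⟨proj hik x.1, proj_mem_domain hik hτ hC hO x.2⟩ := by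
    intro f G hGf x
    rw [← Finset.sum_coe_sort (τ.piAntidiag d)
      fun γ => (∏ v ∈ τ.erase 0, L v x.1 ^ γ v) * G γ (proj hik x.1)]
    exact Finset.sum_congr rfl fun γ _ => by
      rw [← hGf γ ⟨proj hik x.1, proj_mem_domain hik hτ hC hO x.2⟩]
  let Ψ : (∀ γ : τ.piAntidiag d, splineSpace C r (γ.1 0)) →ₗ[ℝ]
      splineSpace (specialOrange C τ) r d :=
    { toFun := fun f => ⟨fun x => ∑ γ : τ.piAntidiag d, (∏ v ∈ τ.erase 0, L v x.1 ^ γ.1 v) *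
          (f γ).1 ⟨proj hik x.1, proj_mem_domain hik hτ hC hO x.2⟩, by
        obtain ⟨G, hG, hGf⟩ := hext f
        exact ⟨_, hval f G hGf, isSpline_sum_medial hik hτ hτ0 hC hO L hG⟩⟩
      map_add' := fun f g => by
        refine Subtype.ext (funext fun x => ?_)
        simp [mul_add, Finset.sum_add_distrib]
      map_smul' := fun a f => by
        refine Subtype.ext (funext fun x => ?_)
        simp [Finset.mul_sum, mul_left_comm] }
  have hinj : Function.Injective Ψ := by
    refine (injective_iff_map_eq_zero Ψ).2 fun f hf => ?_
    obtain ⟨G, hG, hGf⟩ := hext f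
    have h0 := eq_zero_of_sum_medial_eq_zero hik hτ hτ0 hC hL
      (fun γ hγ => (hG γ hγ).1.continuousOn) fun x hx =>
        (hval f G hGf ⟨x, hx⟩).trans (congrFun (congrArg Subtype.val hf) ⟨x, hx⟩)
    refine funext fun γ => Subtype.ext (funext fun u => ?_)
    rw [← hGf γ u]
    exact h0 γ.1 γ.2 u u.2
  have := fun j => hC.finite_splineSpace r j
  have := hO.finite_splineSpace r d
  have h1 := LinearMap.finrank_le_finrank_of_injective hinj
  rw [Module.finrank_pi_fintype] at h1
  rwa [Finset.sum_coe_sort (τ.piAntidiag d)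
    fun γ => Module.finrank ℝ (splineSpace C r (γ 0))] at h1

end Dimension

/-! ### Counting medial indices and layered points -/

section Counting

variable {i k d : ℕ} {τ : Finset (Fin k → ℝ)}

lemma card_piAntidiag_eq_multichoose {X : Type*} [DecidableEq X] (s : Finset X) (m : ℕ) :
    (s.piAntidiag m).card = s.card.multichoose m := by
  have h := Finset.sym_map (n := m) (Function.Embedding.subtype (· ∈ s)) Finset.univ
  rw [← Finset.attach_eq_univ, Finset.attach_map_val, Finset.attach_eq_univ, Finset.sym_univ] at h
  rw [← Finset.map_sym_eq_piAntidiag, Finset.card_map, h, Finset.card_map, Finset.card_univ,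
    Sym.card_sym_eq_multichoose, Fintype.card_coe]

/-- For `i = k` there are no medial vertices besides the origin, and `Nat.multichoose 0` is `1` at
`0` and `0` elsewhere, matching the convention. -/
lemma multichoose_eq_layerCount (hik : i ≤ k) {j : ℕ} (hj : j ≤ d) :
    (k - i).multichoose (d - j) = layerCount k i d j := by
  unfold layerCount
  split_ifs with h h'
  · rw [Nat.multichoose_eq]
    have h1 : k - i + (d - j) - 1 = d + k - j - i - 1 := by omega
    rw [h1]
    exact Nat.choose_symm_of_eq_add (by omega)
  · have h1 : k - i = 0 := by omega
    rw [h1, h', Nat.sub_self, Nat.multichoose_zero_right]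
  · have h1 : k - i = 0 := by omega
    obtain ⟨m, hm⟩ : ∃ m, d - j = m + 1 := ⟨d - j - 1, by omega⟩
    rw [h1, hm, Nat.multichoose_zero_succ]

/-- Erasing the prescribed entry at `x` and restoring it are mutually inverse. -/
lemma card_filter_piAntidiag {X : Type*} [DecidableEq X] {s : Finset X} {x : X} (hx : x ∈ s)
    {j : ℕ} (hj : j ≤ d) :
    ((s.piAntidiag d).filter fun γ => γ x = j).card = ((s.erase x).piAntidiag (d - j)).card := by
  refine Finset.card_bij' (fun γ _ => Function.update γ x 0) (fun β _ => Function.update β x j)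
    ?_ ?_ ?_ ?_
  · intro γ hγ
    rw [Finset.mem_filter, Finset.mem_piAntidiag, ← Finset.add_sum_erase s _ hx] at hγ
    rw [Finset.mem_piAntidiag, Finset.sum_update_of_notMem (Finset.notMem_erase x s)]
    refine ⟨by have := hγ.1.1; have := hγ.2; omega, fun y hy => ?_⟩
    by_cases hyx : y = x
    · rw [hyx, Function.update_self] at hy
      exact absurd rfl hy
    · rw [Function.update_of_ne hyx] at hy
      exact Finset.mem_erase.2 ⟨hyx, hγ.1.2 y hy⟩
  · intro β hβ
    rw [Finset.mem_piAntidiag] at hβ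
    rw [Finset.mem_filter, Finset.mem_piAntidiag, ← Finset.add_sum_erase s _ hx,
      Finset.sum_update_of_notMem (Finset.notMem_erase x s), Function.update_self]
    refine ⟨⟨by rw [hβ.1]; omega, fun y hy => ?_⟩, rfl⟩
    by_cases hyx : y = x
    · rwa [hyx]
    · rw [Function.update_of_ne hyx] at hy
      exact Finset.mem_of_mem_erase (hβ.2 y hy)
  · intro γ hγ
    rw [Finset.mem_filter] at hγ
    rw [Function.update_idem, ← hγ.2, Function.update_eq_self]
  · intro β hβ
    rw [Finset.mem_piAntidiag] at hβ
    have : β x = 0 := not_imp_comm.1 (hβ.2 x) (Finset.notMem_erase x s)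
    rw [Function.update_idem, ← this, Function.update_eq_self]

lemma sum_piAntidiag_eq_sum_layerCount (hik : i ≤ k) (hτ0 : 0 ∈ τ) (hcard : τ.card = k - i + 1)
    (m : ℕ → ℕ) :
    ∑ γ ∈ τ.piAntidiag d, m (γ 0) = ∑ j ∈ Finset.range (d + 1), layerCount k i d j * m j := by
  rw [← Finset.sum_fiberwise_of_maps_to (t := Finset.range (d + 1)) (g := fun γ => γ 0)
    fun γ hγ => Finset.mem_range_succ_iff.2 (le_of_mem_piAntidiag hγ hτ0)]
  refine Finset.sum_congr rfl fun j hj => ?_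
  have hj' := Finset.mem_range_succ_iff.1 hj
  rw [Finset.sum_congr rfl fun γ hγ => by rw [(Finset.mem_filter.1 hγ).2], Finset.sum_const,
    card_filter_piAntidiag hτ0 hj', card_piAntidiag_eq_multichoose, Finset.card_erase_of_mem hτ0,
    hcard, Nat.add_sub_cancel, multichoose_eq_layerCount hik hj', smul_eq_mul]

/-- A union bound over the translates suffices: that no two points coincide follows at the end from
the lower bound on the dimension. -/
lemma encard_layeredSet_le {M : ℕ → Set (Fin i → ℝ)} {m : ℕ → ℕ} (hτ0 : 0 ∈ τ)
    (hm : ∀ j ≤ d, (M j).encard = m j) :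
    (layeredSet τ d M).encard ≤ (∑ γ ∈ τ.piAntidiag d, m (γ 0) : ℕ) := by
  have hsub : layeredSet τ d M ⊆ ⋃ γ ∈ τ.piAntidiag d,
      (fun y => embed k y + domainPoint τ d γ) '' M (γ 0) := by
    rintro _ ⟨j, -, y, hy, _, ⟨γ, hγ, rfl, rfl⟩, rfl⟩
    exact Set.mem_biUnion hγ ⟨y, hy, rfl⟩
  refine (Set.encard_le_encard hsub).trans ((Finset.set_encard_biUnion_le _ _).trans ?_)
  push_cast
  refine Finset.sum_le_sum fun γ hγ => (Set.encard_image_le _ _).trans ?_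
  exact (hm _ (le_of_mem_piAntidiag hγ hτ0)).le

end Counting

end BBSpline

/-! ### The upper and lower bounds combined -/

theorem theorem6 (k i r d : ℕ) (hik : i ≤ k)
    (O : Geometry.SimplicialComplex ℝ (Fin k → ℝ)) (τ : Finset (Fin k → ℝ))
    (hO : BBSpline.IsOrange i O τ)
    (hτ : ∀ v ∈ τ, BBSpline.proj hik v = 0) (hτ0 : (0 : Fin k → ℝ) ∈ τ)
    (C : Set (Finset (Fin i → ℝ))) (hC : C = BBSpline.projectedOrange hik O)
    (M : ℕ → Set (Fin i → ℝ))
    (hM : ∀ j ≤ d,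
      BBSpline.IsMinimalDeterminingSet (BBSpline.scale ((j : ℝ) / (d : ℝ)) C) r j (M j)) :
    BBSpline.IsMinimalDeterminingSet (BBSpline.specialOrange C τ) r d
        (BBSpline.layeredSet τ d M) ∧
      (BBSpline.layeredSet τ d M).encard =
        ∑ j ∈ Finset.range (d + 1), (BBSpline.layerCount k i d j : ℕ∞) * (M j).encard ∧
      Module.rank ℝ (BBSpline.splineSpace (BBSpline.specialOrange C τ) r d) =
        ((∑ j ∈ Finset.range (d + 1), BBSpline.layerCount k i d j * (M j).ncard : ℕ) : Cardinal) ∧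
      (∀ j ≤ d, Module.rank ℝ (BBSpline.splineSpace C r j) = ((M j).ncard : Cardinal)) := by
  open BBSpline in
  have hfan : IsFan C := hC ▸ hO.isFan_projectedOrange hik hτ hτ0
  have hlin := hO.linearIndepOn hτ0
  have hfanO := hfan.specialOrange hik hτ hlin
  have hdim : ∀ j ≤ d, (M j).encard = Module.finrank ℝ (splineSpace C r j) := by
    intro j hj
    rw [((hfan.scale _).isMinimalDeterminingSet_iff.1 (hM j hj)).2,
      hfan.finrank_splineSpace_scale (eq_zero_of_div_eq_zero hj)]
  have hncard : ∀ j ≤ d, (M j).ncard = Module.finrank ℝ (splineSpace C r j) := by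
    intro j hj
    rw [Set.ncard, hdim j hj, ENat.toNat_natCast]
  have hdet := isDeterminingSet_layeredSet hik hτ hτ0 hfan hfanO fun j hj => (hM j hj).1
  have h1 := sum_finrank_le_finrank_specialOrange (r := r) (d := d) hik hτ hτ0 hlin hfan hfanO
  have h2 := encard_layeredSet_le (d := d) hτ0 hdim
  have h3 := hfanO.finrank_le_encard hdet
  -- The cycle closes: dimension ≤ size of the layered set ≤ sum of the layer dimensions ≤
  -- dimension.
  have h4 : (layeredSet τ d M).encard = Module.finrank ℝ (splineSpace (specialOrange C τ) r d) :=
    le_antisymm (h2.trans (by exact_mod_cast h1)) h3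
  have h5 : Module.finrank ℝ (splineSpace (specialOrange C τ) r d) =
      ∑ γ ∈ τ.piAntidiag d, Module.finrank ℝ (splineSpace C r (γ 0)) :=
    le_antisymm (by exact_mod_cast h3.trans h2) h1
  rw [sum_piAntidiag_eq_sum_layerCount hik hτ0 hO.card
    fun j => Module.finrank ℝ (splineSpace C r j)] at h5
  refine ⟨hfanO.isMinimalDeterminingSet_iff.2 ⟨hdet, h4⟩, ?_, ?_, fun j hj => ?_⟩
  · rw [h4, h5]
    push_cast
    refine Finset.sum_congr rfl fun j hj => ?_
    rw [hdim j (Finset.mem_range_succ_iff.1 hj)]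
  · have := hfanO.finite_splineSpace r d
    rw [← Module.finrank_eq_rank, h5]
    congr 1
    exact Finset.sum_congr rfl fun j hj => by rw [hncard j (Finset.mem_range_succ_iff.1 hj)]
  · have := hfan.finite_splineSpace r j
    rw [← Module.finrank_eq_rank, hncard j hj]
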